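/- Let $p,q\ge 2$ be integers with $p+q$ even. On $\mathbb R^{p+q}\ni (x,y)$ let $\Xi=\{(x,y): |x|=|y|\}\setminus\{0\}$, $M=\{(x,y): |x|=|y|=1\}\simeq S^{p-1}\times S^{q-1}$, $\nu(x,y)=|x|$ on $\Xi$, and let $G=O(p,q)=\{g\in GL(p+q,\mathbb R): {}^tg\,I_{p,q}\,g=I_{p,q}\}$ act linearly on $\Xi$, and on $M\simeq \Xi/\mathbb R_{>0}$ by $L_hz=h z/\nu(h z)$. Let $$V^{p,q}=\{f\in C^\infty(M):\widetilde\Delta_Mf=0\},\qquad \widetilde\Delta_M=\Delta_{S^{p-1}}-\Delta_{S^{q-1}}-\tfrac{p+q-4}{4(p+q-3)}\bigl((p-1)(p-2)-(q-1)(q-2)\bigr),$$ be the kernel of the Yamabe operator of $M$ (with metric $g_{S^{p-1}}\oplus(-g_{S^{q-1}})$), and let $G$ act on $C^\infty(M)$ by $(\varpi(h^{-1})f)(z)=\nu(hz)^{-\frac{p+q-4}2}f(L_hz)$. Put $a=-\frac{p+q-4}2$, $\epsilon=(-1)^{\frac{p-q}2}$, and $$S^{a,\epsilon}(\Xi)=\{F\in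 C^\infty(\Xi): F(t\xi)=t^aF(\xi)\ (t>0),\ F(-\xi)=\epsilon F(\xi)\},$$ with $G$ acting by left translations. Then $V^{p,q}$ is $G$-stable, and the resulting representation $\varpi^{p,q}$ of $G$ on $V^{p,q}$ is a subrepresentation of $S^{a,\epsilon}(\Xi)$: there is an injective $G$-intertwining linear map $J:V^{p,q}\to S^{a,\epsilon}(\Xi)$ with $(Jf)|_M=f$ for all $f$. Equivalently, $\varpi^{p,q}$ is a subrepresentation of a degenerate principal series. Let $\xi^o={}^t(1,0,\dots,0,1)$, $E=E_{1,p+q}+E_{p+q,1}$, $A=\exp\mathbb RE$, $N=\exp\{X\in\mathfrak o(p,q):[E,X]=X\}$, let $M_+\simeq O(p-1,q-1)$ be the subgroup of $G$ fixing the first and the last standard basis vector, $m_0=-I_{p+q}$, $M^{\max}=M_+\cup m_0M_+$, $P^{\max}=M^{\max}AN$, $\rho=\frac{p+q-2}2$, and let $\chi_\epsilon$ be the character of $M^{\max}$ which is trivial on $M_+$ with $\chi_\epsilon(m_0)=\epsilon$. Let $$C^\infty\text{-}\mathrm{Ind}_{P^{\max}}^G(\chi_\epsilon\otimes\mathbb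 C_{-1})=\{f\in C^\infty(G): f(g\,m\,e^{tE}n)=\chi_\epsilon(m^{-1})e^{-t(-1+\rho)}f(g)\ \text{for all } g\in G,\ m\in M^{\max},\ t\in\mathbb R,\ n\in N\},$$ with $G$ acting by left translations. Then $F\mapsto(g\mapsto F(g\xi^o))$ is an isomorphism of $G$-representations $S^{a,\epsilon}(\Xi)\to C^\infty\text{-}\mathrm{Ind}_{P^{\max}}^G(\chi_\epsilon\otimes\mathbb C_{-1})$, and its composition with $J$ is an injective $G$-intertwining map from $\varpi^{p,q}$ to $C^\infty\text{-}\mathrm{Ind}_{P^{\max}}^G(\chi_\epsilon\otimes\mathbb C_{-1})$. -/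

import Mathlib

open scoped ContDiff Matrix

noncomputable section

namespace OPQ

/-! ### Smooth functions on embedded submanifolds -/

section Smooth

variable {X E : Type*} [NormedAddCommGroup E] [NormedSpace ℝ E]

/-- For an embedding `ι : X → E` of a set `X` as a submanifold of the vector space `E`:
`f : X → ℂ` is smooth if near every point it is the restriction of a smooth function
on an open set of `E`. -/
def IsSmooth (ι : X → E) (f : X → ℂ) : Prop :=
  ∀ x : X, ∃ U : Set E, IsOpen U ∧ ι x ∈ U ∧
    ∃ F : E → ℂ, ContDiffOn ℝ ∞ F U ∧ ∀ y : X, ι y ∈ U → f y = F (ι y)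

/-- The complex vector space of smooth functions on `X`. -/
def smooth (ι : X → E) : Submodule ℂ (X → ℂ) where
  carrier := {f | IsSmooth ι f}
  zero_mem' := fun _ => ⟨Set.univ, isOpen_univ, trivial, fun _ => 0, contDiffOn_const,
    fun _ _ => rfl⟩
  add_mem' := by
    intro f g hf hg x
    obtain ⟨U, hU, hxU, F, hF, hfF⟩ := hf x
    obtain ⟨W, hW, hxW, H, hH, hgH⟩ := hg x
    refine ⟨U ∩ W, hU.inter hW, ⟨hxU, hxW⟩, fun v => F v + H v,
      (hF.mono Set.inter_subset_left).add (hH.mono Set.inter_subset_right), ?_⟩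
    intro y hy
    simp [hfF y hy.1, hgH y hy.2]
  smul_mem' := by
    intro c f hf x
    obtain ⟨U, hU, hxU, F, hF, hfF⟩ := hf x
    refine ⟨U, hU, hxU, fun v => c * F v, contDiffOn_const.mul hF, ?_⟩
    intro y hy
    simp [hfF y hy]

/-- Pull-back of a smooth function along a map which is the restriction of a smooth map. -/
theorem IsSmooth.comp {Y E' : Type*} [NormedAddCommGroup E'] [NormedSpace ℝ E']
    {ι : X → E} {κ : Y → E'} {f : X → ℂ} (hf : IsSmooth ι f) (φ : Y → X) (Φ : E' → E)
    (hΦ : ∀ y, ∃ U : Set E', IsOpen U ∧ κ y ∈ U ∧ ContDiffOn ℝ ∞ Φ U)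
    (h : ∀ y, ι (φ y) = Φ (κ y)) : IsSmooth κ (fun y => f (φ y)) := by
  intro y
  obtain ⟨U, hU, hxU, F, hF, hfF⟩ := hf (φ y)
  obtain ⟨W, hW, hyW, hΦW⟩ := hΦ y
  refine ⟨W ∩ Φ ⁻¹' U, hΦW.continuousOn.isOpen_inter_preimage hW hU,
    ⟨hyW, by simpa [← h] using hxU⟩, fun v => F (Φ v),
    hF.comp (hΦW.mono Set.inter_subset_left) (fun v hv => hv.2), ?_⟩
  intro z hz
  have := hfF (φ z) (by rw [h]; exact hz.2)
  simpa [h] using this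

theorem IsSmooth.mul {ι : X → E} {f g : X → ℂ} (hf : IsSmooth ι f) (hg : IsSmooth ι g) :
    IsSmooth ι (fun x => f x * g x) := by
  intro x
  obtain ⟨U, hU, hxU, F, hF, hfF⟩ := hf x
  obtain ⟨W, hW, hxW, H, hH, hgH⟩ := hg x
  refine ⟨U ∩ W, hU.inter hW, ⟨hxU, hxW⟩, fun v => F v * H v,
    (hF.mono Set.inter_subset_left).mul (hH.mono Set.inter_subset_right), ?_⟩
  intro y hy
  simp [hfF y hy.1, hgH y hy.2]

end Smooth

/-! ### The space `ℝ^{p,q}`, the light cone `Ξ`, the product of spheres `M` -/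

/-- `ℝ^{p+q}` with coordinates `(x, y) = (x₁, …, x_p, y₁, …, y_q)`. -/
abbrev Space (p q : ℕ) : Type := Fin p ⊕ Fin q → ℝ

abbrev Mat (p q : ℕ) : Type := Matrix (Fin p ⊕ Fin q) (Fin p ⊕ Fin q) ℝ

variable {p q : ℕ}

/-- The Euclidean norm `|x|` of the first component of `z = (x, y)`. -/
def normX (z : Space p q) : ℝ := √(∑ i, z (Sum.inl i) ^ 2)

/-- The Euclidean norm `|y|` of the second component of `z = (x, y)`. -/
def normY (z : Space p q) : ℝ := √(∑ j, z (Sum.inr j) ^ 2)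

variable (p q) in
/-- The light cone `Ξ`. -/
def cone : Set (Space p q) := {z | normX z = normY z} \ {0}

variable (p q) in
/-- `M = S^{p-1} × S^{q-1}`. -/
def spheres : Set (Space p q) := {z | normX z = 1 ∧ normY z = 1}

variable (p q) in
/-- `C^∞(M)`. -/
abbrev SmoothM : Submodule ℂ (spheres p q → ℂ) :=
  smooth (Subtype.val : spheres p q → Space p q)

/-- `(x, y) ↦ (x/|x|, y/|y|)`. -/
def radial (z : Space p q) : Space p q :=
  Sum.elim (fun i => z (Sum.inl i) / normX z) (fun j => z (Sum.inr j) / normY z)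

/-- The function `ν(x, y) = |x|` (which is also `|y|` on the light cone). -/
abbrev nu (z : Space p q) : ℝ := normX z

/-! ### The group `O(p,q)` and its Lie algebra -/

variable (p q) in
/-- `I_{p,q} = diag(1, …, 1, -1, …, -1)`. -/
abbrev Ipq : Mat p q := LieAlgebra.Orthogonal.indefiniteDiagonal (Fin p) (Fin q) ℝ

variable (p q) in
/-- The indefinite orthogonal group `O(p,q)`. -/
def G : Subgroup (GL (Fin p ⊕ Fin q) ℝ) where
  carrier := {g | (g : Mat p q)ᵀ * Ipq p q * (g : Mat p q) = Ipq p q}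
  one_mem' := by simp
  mul_mem' := by
    intro a b ha hb
    simp only [Set.mem_ofPred_eq, Units.val_mul, Matrix.transpose_mul] at *
    calc _ = (b : Mat p q)ᵀ * ((a : Mat p q)ᵀ * Ipq p q * (a : Mat p q)) * (b : Mat p q) := by
          simp only [mul_assoc]
      _ = _ := by rw [ha, hb]
  inv_mem' := by
    intro a ha
    simp only [Set.mem_ofPred_eq] at *
    have h1 : (a : Mat p q) * ((a⁻¹ : GL _ ℝ) : Mat p q) = 1 := by
      rw [← Units.val_mul]; simp
    have h2 : ((a⁻¹ : GL _ ℝ) : Mat p q)ᵀ * (a : Mat p q)ᵀ = 1 := by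
      rw [← Matrix.transpose_mul, h1, Matrix.transpose_one]
    calc _ = ((a⁻¹ : GL _ ℝ) : Mat p q)ᵀ * ((a : Mat p q)ᵀ * Ipq p q * (a : Mat p q))
            * ((a⁻¹ : GL _ ℝ) : Mat p q) := by rw [ha]
      _ = (((a⁻¹ : GL _ ℝ) : Mat p q)ᵀ * (a : Mat p q)ᵀ) * Ipq p q
            * ((a : Mat p q) * ((a⁻¹ : GL _ ℝ) : Mat p q)) := by simp only [mul_assoc]
      _ = _ := by rw [h1, h2]; simp

/-- The matrix of an element of `O(p,q)`. -/
abbrev mat (g : G p q) : Mat p q := ((g : GL (Fin p ⊕ Fin q) ℝ) : Mat p q)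

variable (p q) in
/-- The entries of a matrix in `O(p,q)`; this embeds `O(p,q)` in a vector space. -/
def entries (g : G p q) : Fin p ⊕ Fin q → Fin p ⊕ Fin q → ℝ := fun i j => mat g i j

variable (p q) in
/-- `C^∞(G)`. -/
abbrev SmoothG : Submodule ℂ (G p q → ℂ) := smooth (entries p q)

variable (p q) in
/-- The Lie algebra `𝔤₀ = 𝔬(p,q)`. -/
def lieAlg : Set (Mat p q) := {X | Xᵀ * Ipq p q + Ipq p q * X = 0}

/-- The exponential map `𝔤₀ → G`. -/
def expG (X : Mat p q) (hX : X ∈ lieAlg p q) : G p q :=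
  ⟨(Matrix.isUnit_exp X).unit, by
    have hI : Ipq p q * Ipq p q = 1 := by
      unfold Ipq LieAlgebra.Orthogonal.indefiniteDiagonal
      rw [Matrix.diagonal_mul_diagonal, ← Matrix.diagonal_one]
      congr 1
      funext k
      cases k <;> simp
    have hu : IsUnit (Ipq p q) := IsUnit.of_mul_eq_one _ hI
    have hinv : (Ipq p q)⁻¹ = Ipq p q := Matrix.inv_eq_left_inv hI
    have hXt : Xᵀ = Ipq p q * (-X) * (Ipq p q)⁻¹ := by
      have h : Xᵀ * Ipq p q = Ipq p q * (-X) := by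
        rw [mul_neg]; exact eq_neg_of_add_eq_zero_left hX
      rw [← h, hinv, mul_assoc, hI, mul_one]
    change (NormedSpace.exp X)ᵀ * Ipq p q * NormedSpace.exp X = Ipq p q
    rw [← Matrix.exp_transpose, hXt, Matrix.exp_conj _ _ hu, Matrix.exp_neg, hinv]
    have h3 : (NormedSpace.exp X)⁻¹ * NormedSpace.exp X = 1 :=
      Matrix.nonsing_inv_mul _ ((Matrix.isUnit_iff_isUnit_det _).1 (Matrix.isUnit_exp X))
    rw [mul_assoc _ (Ipq p q) (Ipq p q), hI, mul_one, mul_assoc, h3, mul_one]⟩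

/-! ### The actions of `O(p,q)` on the light cone and on `M` -/

theorem form_eq (z : Space p q) : z ⬝ᵥ (Ipq p q *ᵥ z) = normX z ^ 2 - normY z ^ 2 := by
  rw [normX, normY, Real.sq_sqrt (Finset.sum_nonneg fun _ _ => sq_nonneg _),
    Real.sq_sqrt (Finset.sum_nonneg fun _ _ => sq_nonneg _)]
  simp [LieAlgebra.Orthogonal.indefiniteDiagonal, Matrix.mulVec_diagonal, dotProduct,
    Fintype.sum_sum_type, pow_two, sub_eq_add_neg]

theorem normX_nonneg (z : Space p q) : 0 ≤ normX z := Real.sqrt_nonneg _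

theorem normY_nonneg (z : Space p q) : 0 ≤ normY z := Real.sqrt_nonneg _

theorem form_mulVec (g : G p q) (z : Space p q) :
    (mat g *ᵥ z) ⬝ᵥ (Ipq p q *ᵥ (mat g *ᵥ z)) = z ⬝ᵥ (Ipq p q *ᵥ z) := by
  have h : (mat g)ᵀ * Ipq p q * mat g = Ipq p q := g.2
  conv_rhs => rw [← h]
  rw [← Matrix.mulVec_mulVec, ← Matrix.mulVec_mulVec, Matrix.dotProduct_mulVec z,
    Matrix.vecMul_transpose]

theorem mat_mul_inv (g : G p q) : mat g * mat g⁻¹ = 1 := by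
  simp [mat]

theorem mat_inv_mul (g : G p q) : mat g⁻¹ * mat g = 1 := by
  simp [mat]

theorem mulVec_mem_cone (g : G p q) {z : Space p q} (hz : z ∈ cone p q) :
    mat g *ᵥ z ∈ cone p q := by
  refine ⟨?_, ?_⟩
  · have h := form_mulVec g z
    have hz1 : normX z = normY z := hz.1
    rw [form_eq, form_eq, hz1] at h
    have h2 : normX (mat g *ᵥ z) ^ 2 = normY (mat g *ᵥ z) ^ 2 := by linarith
    exact (pow_left_inj₀ (normX_nonneg _) (normY_nonneg _) two_ne_zero).1 h2
  · intro h0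
    have h0' : mat g *ᵥ z = 0 := h0
    apply hz.2
    have : mat g⁻¹ *ᵥ (mat g *ᵥ z) = z := by
      rw [Matrix.mulVec_mulVec, mat_inv_mul, Matrix.one_mulVec]
    rw [Set.mem_singleton_iff, ← this, h0', Matrix.mulVec_zero]

/-- The action of `G` on the light cone by the natural representation. -/
instance : MulAction (G p q) (cone p q) where
  smul g ξ := ⟨mat g *ᵥ (ξ : Space p q), mulVec_mem_cone g ξ.2⟩
  one_smul ξ := Subtype.ext (by
    change mat (1 : G p q) *ᵥ (ξ : Space p q) = ξ
    simp [mat])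
  mul_smul g h ξ := Subtype.ext (by
    change mat (g * h) *ᵥ (ξ : Space p q) = mat g *ᵥ (mat h *ᵥ (ξ : Space p q))
    simp [mat, Matrix.mulVec_mulVec])

theorem coe_smul (g : G p q) (ξ : cone p q) :
    ((g • ξ : cone p q) : Space p q) = mat g *ᵥ (ξ : Space p q) := rfl

theorem normX_pos (ξ : cone p q) : 0 < normX (ξ : Space p q) := by
  rcases (normX_nonneg (ξ : Space p q)).lt_or_eq with h | h
  · exact h
  · exfalso
    have hy : normY (ξ : Space p q) = 0 := by rw [← show _ = _ from ξ.2.1, ← h]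
    have hx : normX (ξ : Space p q) = 0 := h.symm
    apply ξ.2.2
    rw [normX, Real.sqrt_eq_zero (Finset.sum_nonneg fun _ _ => sq_nonneg _),
      Finset.sum_eq_zero_iff_of_nonneg (fun _ _ => sq_nonneg _)] at hx
    rw [normY, Real.sqrt_eq_zero (Finset.sum_nonneg fun _ _ => sq_nonneg _),
      Finset.sum_eq_zero_iff_of_nonneg (fun _ _ => sq_nonneg _)] at hy
    funext k
    cases k with
    | inl i => simpa using hx i (Finset.mem_univ i)
    | inr j => simpa using hy j (Finset.mem_univ j)

theorem normX_smul {t : ℝ} (ht : 0 ≤ t) (z : Space p q) : normX (t • z) = t * normX z := by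
  simp only [normX, Pi.smul_apply, smul_eq_mul, mul_pow, ← Finset.mul_sum]
  rw [Real.sqrt_mul (sq_nonneg t), Real.sqrt_sq ht]

theorem normY_smul {t : ℝ} (ht : 0 ≤ t) (z : Space p q) : normY (t • z) = t * normY z := by
  simp only [normY, Pi.smul_apply, smul_eq_mul, mul_pow, ← Finset.mul_sum]
  rw [Real.sqrt_mul (sq_nonneg t), Real.sqrt_sq ht]

/-- The dilation `ξ ↦ t ξ` of the light cone, `t > 0`. -/
def dilate (t : ℝ) (ht : 0 < t) (ξ : cone p q) : cone p q :=
  ⟨t • (ξ : Space p q), by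
    refine ⟨?_, ?_⟩
    · have h : normX (ξ : Space p q) = normY (ξ : Space p q) := ξ.2.1
      change normX _ = normY _
      rw [normX_smul ht.le, normY_smul ht.le, h]
    · intro h
      exact ξ.2.2 ((smul_eq_zero.1 (show t • (ξ : Space p q) = 0 from h)).resolve_left ht.ne')⟩

/-- The map `ξ ↦ -ξ` of the light cone. -/
def negCone (ξ : cone p q) : cone p q :=
  ⟨-(ξ : Space p q), by
    refine ⟨?_, ?_⟩
    · have h : normX (ξ : Space p q) = normY (ξ : Space p q) := ξ.2.1
      simpa [normX, normY] using h
    · intro h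
      exact ξ.2.2 (neg_eq_zero.1 (show -(ξ : Space p q) = 0 from h))⟩

/-- The inclusion `M ⊂ Ξ`. -/
def toCone (z : spheres p q) : cone p q :=
  ⟨z, by
    refine ⟨?_, ?_⟩
    · exact z.2.1.trans z.2.2.symm
    · intro h
      have h1 : normX (z : Space p q) = 1 := z.2.1
      rw [show (z : Space p q) = 0 from h] at h1
      simp [normX] at h1⟩

theorem radial_eq (ξ : cone p q) :
    radial (ξ : Space p q) = (nu (ξ : Space p q))⁻¹ • (ξ : Space p q) := by
  have h : normX (ξ : Space p q) = normY (ξ : Space p q) := ξ.2.1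
  funext k
  cases k with
  | inl i => simp [radial, nu, div_eq_inv_mul]
  | inr j => simp [radial, nu, div_eq_inv_mul, h]

/-- The projection `Φ : Ξ → M`, `(x, y) ↦ (x/|x|, y/|y|)`. -/
def proj (ξ : cone p q) : spheres p q :=
  ⟨radial (ξ : Space p q), by
    have h0 := normX_pos ξ
    have h : normX (ξ : Space p q) = normY (ξ : Space p q) := ξ.2.1
    rw [radial_eq]
    refine ⟨?_, ?_⟩
    · rw [normX_smul (inv_nonneg.2 h0.le), inv_mul_cancel₀ h0.ne']
    · rw [normY_smul (inv_nonneg.2 h0.le), ← h, inv_mul_cancel₀ h0.ne']⟩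

/-- The action `L_h` of `h ∈ G` on `M ≃ Ξ / ℝ₊`. -/
def L (h : G p q) (z : spheres p q) : spheres p q := proj (h • toCone z)

/-- The twisting factor `ν(h · z)`, `h ∈ G`, `z ∈ M`. -/
def nuAct (h : G p q) (z : spheres p q) : ℝ := nu ((h • toCone z : cone p q) : Space p q)

theorem nuAct_pos (h : G p q) (z : spheres p q) : 0 < nuAct h z := normX_pos _

theorem smul_dilate (g : G p q) (t : ℝ) (ht : 0 < t) (ξ : cone p q) :
    g • dilate t ht ξ = dilate t ht (g • ξ) := by
  apply Subtype.ext
  rw [coe_smul]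
  exact Matrix.mulVec_smul _ _ _

theorem smul_negCone (g : G p q) (ξ : cone p q) : g • negCone ξ = negCone (g • ξ) := by
  apply Subtype.ext
  rw [coe_smul]
  exact Matrix.mulVec_neg _ _

theorem toCone_proj (ξ : cone p q) :
    toCone (proj ξ) = dilate (nu (ξ : Space p q))⁻¹ (inv_pos.2 (normX_pos ξ)) ξ :=
  Subtype.ext (radial_eq ξ)

theorem proj_toCone (z : spheres p q) : proj (toCone z) = z := by
  apply Subtype.ext
  change radial ((toCone z : cone p q) : Space p q) = z
  rw [radial_eq]
  change (normX (z : Space p q))⁻¹ • (z : Space p q) = z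
  rw [show normX (z : Space p q) = 1 from z.2.1]
  simp

theorem proj_dilate (t : ℝ) (ht : 0 < t) (ξ : cone p q) : proj (dilate t ht ξ) = proj ξ := by
  apply Subtype.ext
  change radial ((dilate t ht ξ : cone p q) : Space p q) = radial (ξ : Space p q)
  rw [radial_eq, radial_eq]
  change (normX (t • (ξ : Space p q)))⁻¹ • t • (ξ : Space p q) = _
  rw [normX_smul ht.le, smul_smul]
  congr 1
  have := (normX_pos ξ).ne'
  field_simp

theorem L_one (z : spheres p q) : L 1 z = z := by
  rw [L, one_smul, proj_toCone]

theorem L_mul (g h : G p q) (z : spheres p q) : L (g * h) z = L g (L h z) := by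
  rw [L, L, L, toCone_proj, smul_dilate, proj_dilate, mul_smul]

theorem nuAct_one (z : spheres p q) : nuAct 1 z = 1 := by
  rw [nuAct, one_smul]; exact z.2.1

theorem nuAct_mul (g h : G p q) (z : spheres p q) :
    nuAct (g * h) z = nuAct g (L h z) * nuAct h z := by
  rw [nuAct, nuAct, L, toCone_proj, smul_dilate, mul_smul]
  change _ = normX ((nu ((h • toCone z : cone p q) : Space p q))⁻¹ •
    ((g • h • toCone z : cone p q) : Space p q)) * _
  have h0 := normX_pos (h • toCone z)
  rw [normX_smul (inv_nonneg.2 h0.le), nuAct]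
  have := h0.ne'
  simp only [nu] at *
  field_simp

/-! ### The representations `ϖ_λ` on `C^∞(M)` -/

theorem contDiff_mulVec (A : Mat p q) : ContDiff ℝ ∞ (fun v : Space p q => A *ᵥ v) :=
  (Matrix.mulVecLin A).toContinuousLinearMap.contDiff

theorem contDiffOn_normX : ContDiffOn ℝ ∞ (normX : Space p q → ℝ) {v | 0 < normX v} := by
  intro v hv
  have hv' : 0 < normX v := hv
  refine ContDiffAt.contDiffWithinAt ?_
  refine ContDiffAt.sqrt (ContDiff.contDiffAt (by fun_prop)) ?_
  intro h
  rw [normX, h, Real.sqrt_zero] at hv'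
  exact lt_irrefl _ hv'

theorem continuous_normX : Continuous (normX : Space p q → ℝ) := by
  unfold normX; fun_prop

theorem continuous_normY : Continuous (normY : Space p q → ℝ) := by
  unfold normY; fun_prop

/-- The operator `(T f)(z) = ν(h · z)^{-λ} f(L_h z)` preserves smoothness. -/
theorem smooth_twist (lam : ℂ) (h : G p q) {f : spheres p q → ℂ} (hf : f ∈ SmoothM p q) :
    (fun z => ((nuAct h z : ℝ) : ℂ) ^ (-lam) * f (L h z)) ∈ SmoothM p q := by
  set W : Set (Space p q) := {v | 0 < normX (mat h *ᵥ v)} with hWdef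
  have hW : IsOpen W :=
    isOpen_lt continuous_const (continuous_normX.comp (contDiff_mulVec (mat h)).continuous)
  have hmem : ∀ z : spheres p q, (z : Space p q) ∈ W := fun z => nuAct_pos h z
  have hN : ContDiffOn ℝ ∞ (fun v : Space p q => normX (mat h *ᵥ v)) W :=
    contDiffOn_normX.comp (contDiff_mulVec (mat h)).contDiffOn (fun v hv => hv)
  refine IsSmooth.mul ?_ ?_
  · intro z
    refine ⟨W, hW, hmem z, fun v => Complex.exp ((Real.log (normX (mat h *ᵥ v)) : ℂ) * -lam),
      ?_, ?_⟩
    · have h1 : ContDiffOn ℝ ∞ (fun v : Space p q => Real.log (normX (mat h *ᵥ v))) W :=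
        hN.log (fun v hv => ne_of_gt hv)
      have h2 : ContDiffOn ℝ ∞
          (fun v : Space p q => ((Real.log (normX (mat h *ᵥ v)) : ℝ) : ℂ)) W :=
        Complex.ofRealCLM.contDiff.comp_contDiffOn h1
      exact (h2.mul contDiffOn_const).cexp
    · intro y _
      have hpos := nuAct_pos h y
      change ((nuAct h y : ℝ) : ℂ) ^ (-lam) = _
      rw [Complex.cpow_def_of_ne_zero (by exact_mod_cast hpos.ne'), ← Complex.ofReal_log hpos.le]
      rfl
  · refine IsSmooth.comp (f := f) hf (L h)
      (fun v => (normX (mat h *ᵥ v))⁻¹ • (mat h *ᵥ v)) (fun z => ⟨W, hW, hmem z, ?_⟩) ?_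
    · exact (hN.inv (fun v hv => ne_of_gt hv)).smul (contDiff_mulVec (mat h)).contDiffOn
    · intro z
      exact radial_eq (h • toCone z)

variable (p q) in
/-- The representation `ϖ_λ` of `G` on `C^∞(M)`:
`(ϖ_λ(h⁻¹) f)(z) = ν(h · z)^{-λ} f(L_h z)`. -/
def varpi (lam : ℂ) : Representation ℂ (G p q) (SmoothM p q) where
  toFun h :=
    { toFun := fun f =>
        ⟨fun z => ((nuAct h⁻¹ z : ℝ) : ℂ) ^ (-lam) * (f : spheres p q → ℂ) (L h⁻¹ z),
          smooth_twist lam h⁻¹ f.2⟩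
      map_add' := fun f g => Subtype.ext (funext fun z => by simp [mul_add])
      map_smul' := fun c f => Subtype.ext (funext fun z => by simp [mul_left_comm]) }
  map_one' := by
    refine LinearMap.ext fun f => Subtype.ext (funext fun z => ?_)
    simp [nuAct_one, L_one]
  map_mul' g h := by
    refine LinearMap.ext fun f => Subtype.ext (funext fun z => ?_)
    simp only [mul_inv_rev, LinearMap.coe_mk, AddHom.coe_mk, Module.End.mul_apply]
    rw [nuAct_mul, L_mul, Complex.ofReal_mul,
      Complex.mul_cpow_ofReal_nonneg (nuAct_pos _ _).le (nuAct_pos _ _).le]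
    ring

/-! ### The Yamabe operator on `M = S^{p-1} × S^{q-1}` and the space `V^{p,q}` -/

open Classical in
/-- The extension of a function on `M` to `{x ≠ 0, y ≠ 0}` which is homogeneous of degree `0`
in `x` and in `y`: `(x, y) ↦ f(x/|x|, y/|y|)`. -/
def extend (f : spheres p q → ℂ) (z : Space p q) : ℂ :=
  if h : radial z ∈ spheres p q then f ⟨radial z, h⟩ else 0

/-- The second partial derivative `∂²F/∂z_k²` at `z`. -/
def partial2 (k : Fin p ⊕ Fin q) (F : Space p q → ℂ) (z : Space p q) : ℂ :=
  iteratedDeriv 2 (fun t : ℝ => F (z + t • Pi.single k 1)) 0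

/-- The Laplace-Beltrami operator `Δ_{S^{p-1}}` of the unit sphere, acting on the first
variable of functions on `M`: the Euclidean Laplacian in `x` of the extension of `f` which is
homogeneous of degree `0`, evaluated on the sphere. -/
def lapX (f : spheres p q → ℂ) (z : spheres p q) : ℂ :=
  ∑ i : Fin p, partial2 (Sum.inl i) (extend f) z

/-- The Laplace-Beltrami operator `Δ_{S^{q-1}}` acting on the second variable. -/
def lapY (f : spheres p q → ℂ) (z : spheres p q) : ℂ :=
  ∑ j : Fin q, partial2 (Sum.inr j) (extend f) z

/-- The Yamabe operator `Δ_M - (n-2)/(4(n-1)) K_M` of `M = S^{p-1} × S^{q-1}` with the metric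
`g_{S^{p-1}} ⊕ (-g_{S^{q-1}})`; here `n = p + q - 2`, `Δ_M = Δ_{S^{p-1}} - Δ_{S^{q-1}}`, and
the scalar curvature is `K_M = (p-1)(p-2) - (q-1)(q-2)`. -/
def yamabe (f : spheres p q → ℂ) (z : spheres p q) : ℂ :=
  lapX f z - lapY f z -
    ((p : ℂ) + q - 4) / (4 * ((p : ℂ) + q - 3)) *
      (((p : ℂ) - 1) * (p - 2) - ((q : ℂ) - 1) * (q - 2)) * f z

theorem normX_pos_of_mem (z : spheres p q) : 0 < normX (z : Space p q) := by
  rw [show normX (z : Space p q) = 1 from z.2.1]; exact one_pos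

theorem normY_pos_of_mem (z : spheres p q) : 0 < normY (z : Space p q) := by
  rw [show normY (z : Space p q) = 1 from z.2.2]; exact one_pos

theorem radial_mem {v : Space p q} (hx : 0 < normX v) (hy : 0 < normY v) :
    radial v ∈ spheres p q := by
  refine ⟨?_, ?_⟩
  · have h : normX (radial v) = normX ((normX v)⁻¹ • v) := by
      simp [normX, radial, div_eq_inv_mul]
    rw [h, normX_smul (inv_nonneg.2 hx.le), inv_mul_cancel₀ hx.ne']
  · have h : normY (radial v) = normY ((normY v)⁻¹ • v) := by
      simp [normY, radial, div_eq_inv_mul]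
    rw [h, normY_smul (inv_nonneg.2 hy.le), inv_mul_cancel₀ hy.ne']

theorem contDiffAt_radial {v : Space p q} (hx : 0 < normX v) (hy : 0 < normY v) :
    ContDiffAt ℝ ∞ (radial : Space p q → Space p q) v := by
  have hX : ContDiffAt ℝ ∞ (normX : Space p q → ℝ) v := by
    refine ContDiffAt.sqrt (ContDiff.contDiffAt (by fun_prop)) ?_
    intro h
    rw [normX, h, Real.sqrt_zero] at hx
    exact lt_irrefl _ hx
  have hY : ContDiffAt ℝ ∞ (normY : Space p q → ℝ) v := by
    refine ContDiffAt.sqrt (ContDiff.contDiffAt (by fun_prop)) ?_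
    intro h
    rw [normY, h, Real.sqrt_zero] at hy
    exact lt_irrefl _ hy
  rw [contDiffAt_pi]
  intro k
  cases k with
  | inl i => exact (ContDiff.contDiffAt (by fun_prop)).div hX hx.ne'
  | inr j => exact (ContDiff.contDiffAt (by fun_prop)).div hY hy.ne'

/-- The extension of a smooth function on `M` is smooth near `M`. -/
theorem contDiffAt_extend {f : spheres p q → ℂ} (hf : f ∈ SmoothM p q) (z : spheres p q) :
    ContDiffAt ℝ ∞ (extend f) (z : Space p q) := by
  have hx := normX_pos_of_mem z
  have hy := normY_pos_of_mem z
  have hrz : radial (z : Space p q) = z := by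
    have := congrArg Subtype.val (proj_toCone z)
    exact this
  obtain ⟨U, hU, hzU, F, hF, hfF⟩ := hf z
  have hr := contDiffAt_radial hx hy
  have hFz : ContDiffAt ℝ ∞ F (radial (z : Space p q)) := by
    rw [hrz]; exact hF.contDiffAt (hU.mem_nhds hzU)
  refine (hFz.comp (z : Space p q) hr).congr_of_eventuallyEq ?_
  have e1 : ∀ᶠ v in nhds (z : Space p q), 0 < normX v :=
    continuous_normX.continuousAt.eventually_const_lt hx
  have e2 : ∀ᶠ v in nhds (z : Space p q), 0 < normY v :=
    continuous_normY.continuousAt.eventually_const_lt hy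
  have e3 : ∀ᶠ v in nhds (z : Space p q), radial v ∈ U :=
    hr.continuousAt.eventually (by rw [hrz]; exact hU.mem_nhds hzU)
  filter_upwards [e1, e2, e3] with v h1 h2 h3
  rw [extend, dif_pos (radial_mem h1 h2)]
  exact hfF _ h3

theorem contDiffAt_line {f : spheres p q → ℂ} (hf : f ∈ SmoothM p q) (z : spheres p q)
    (k : Fin p ⊕ Fin q) :
    ContDiffAt ℝ 2 (fun t : ℝ => extend f ((z : Space p q) + t • Pi.single k 1)) 0 := by
  have h : ContDiffAt ℝ 2 (extend f) ((z : Space p q) + (0 : ℝ) • Pi.single k 1) := by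
    rw [zero_smul, add_zero]
    exact (contDiffAt_extend hf z).of_le (WithTop.coe_le_coe.2 le_top)
  have hl : ContDiff ℝ 2 (fun t : ℝ => (z : Space p q) + t • (Pi.single k 1 : Space p q)) :=
    contDiff_const.add (contDiff_id.smul contDiff_const)
  exact ContDiffAt.comp (f := fun t : ℝ => (z : Space p q) + t • (Pi.single k 1 : Space p q))
    (0 : ℝ) h hl.contDiffAt

theorem extend_add (f g : spheres p q → ℂ) (v : Space p q) :
    extend (f + g) v = extend f v + extend g v := by
  unfold extend; split_ifs <;> simp

theorem extend_smul (c : ℂ) (f : spheres p q → ℂ) (v : Space p q) :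
    extend (c • f) v = c • extend f v := by
  unfold extend; split_ifs <;> simp

theorem partial2_add {f g : spheres p q → ℂ} (hf : f ∈ SmoothM p q) (hg : g ∈ SmoothM p q)
    (z : spheres p q) (k : Fin p ⊕ Fin q) :
    partial2 k (extend (f + g)) z = partial2 k (extend f) z + partial2 k (extend g) z := by
  unfold partial2
  simp only [extend_add]
  exact iteratedDeriv_fun_add (contDiffAt_line hf z k) (contDiffAt_line hg z k)

theorem partial2_smul {f : spheres p q → ℂ} (hf : f ∈ SmoothM p q) (c : ℂ)
    (z : spheres p q) (k : Fin p ⊕ Fin q) :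
    partial2 k (extend (c • f)) z = c * partial2 k (extend f) z := by
  unfold partial2
  simp only [extend_smul]
  exact iteratedDeriv_fun_const_smul (contDiffAt_line hf z k) c

variable (p q) in
/-- `V^{p,q}`: the kernel of the Yamabe operator in `C^∞(M)`. -/
def V : Submodule ℂ (SmoothM p q) where
  carrier := {f | ∀ z, yamabe (f : spheres p q → ℂ) z = 0}
  zero_mem' := by
    intro z
    simp [yamabe, lapX, lapY, partial2, extend]
  add_mem' := by
    intro f g hf hg z
    have h1 := hf z
    have h2 := hg z
    simp only [yamabe, lapX, lapY, Submodule.coe_add, Pi.add_apply,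
      partial2_add f.2 g.2, Finset.sum_add_distrib] at *
    linear_combination h1 + h2
  smul_mem' := by
    intro c f hf z
    have h1 := hf z
    simp only [yamabe, lapX, lapY, Submodule.coe_smul, Pi.smul_apply, smul_eq_mul,
      partial2_smul f.2, ← Finset.mul_sum] at *
    linear_combination c * h1

/-! ### The spaces `S^{a,ε}(Ξ)` of homogeneous functions on the light cone -/

variable (p q) in
/-- `S^{a,ε}(Ξ)`: the smooth functions on the light cone with `F(t ξ) = t^a F(ξ)` for `t > 0`
and `F(-ξ) = ε F(ξ)`. -/
def S (a : ℂ) (ε : ℤˣ) : Submodule ℂ (cone p q → ℂ) where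
  carrier := {F | F ∈ smooth (Subtype.val : cone p q → Space p q) ∧
    (∀ (t : ℝ) (ht : 0 < t) (ξ : cone p q), F (dilate t ht ξ) = (t : ℂ) ^ a * F ξ) ∧
    ∀ ξ : cone p q, F (negCone ξ) = ((ε : ℤ) : ℂ) * F ξ}
  zero_mem' := ⟨Submodule.zero_mem _, by simp, by simp⟩
  add_mem' := by
    rintro F H ⟨h1, h2, h3⟩ ⟨k1, k2, k3⟩
    refine ⟨Submodule.add_mem _ h1 k1, fun t ht ξ => ?_, fun ξ => ?_⟩
    · simp [h2, k2, mul_add]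
    · simp [h3, k3, mul_add]
  smul_mem' := by
    rintro c F ⟨h1, h2, h3⟩
    refine ⟨Submodule.smul_mem _ c h1, fun t ht ξ => ?_, fun ξ => ?_⟩
    · simp [h2, mul_left_comm]
    · simp [h3, mul_left_comm]

theorem translate_mem_S {a : ℂ} {ε : ℤˣ} (g : G p q) {F : cone p q → ℂ} (hF : F ∈ S p q a ε) :
    (fun ξ => F (g • ξ)) ∈ S p q a ε := by
  refine ⟨?_, fun t ht ξ => ?_, fun ξ => ?_⟩
  · exact IsSmooth.comp (f := F) hF.1 (fun ξ => g • ξ) (fun v => mat g *ᵥ v)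
      (fun ξ => ⟨Set.univ, isOpen_univ, trivial, (contDiff_mulVec _).contDiffOn⟩)
      (fun ξ => rfl)
  · simp only [smul_dilate, hF.2.1]
  · simp only [smul_negCone, hF.2.2]

variable (p q) in
/-- The representation of `G` on `S^{a,ε}(Ξ)` by left translations. -/
def coneRep (a : ℂ) (ε : ℤˣ) : Representation ℂ (G p q) (S p q a ε) where
  toFun g :=
    { toFun := fun F => ⟨fun ξ => (F : cone p q → ℂ) (g⁻¹ • ξ), translate_mem_S g⁻¹ F.2⟩
      map_add' := fun _ _ => rfl
      map_smul' := fun _ _ => rfl }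
  map_one' := by
    refine LinearMap.ext fun F => Subtype.ext (funext fun ξ => ?_)
    simp
  map_mul' g h := by
    refine LinearMap.ext fun F => Subtype.ext (funext fun ξ => ?_)
    simp [mul_smul]

/-! ### The maximal parabolic subgroup and the degenerate principal series -/

variable (p q) in
/-- `m₀ = -I_{p+q}`. -/
def m0 : G p q := ⟨-1, by
  change (-1 : Mat p q)ᵀ * Ipq p q * (-1 : Mat p q) = Ipq p q
  simp⟩

theorem m0_comm (g : G p q) : m0 p q * g = g * m0 p q := by
  apply Subtype.ext
  apply Units.ext
  change (-1 : Mat p q) * mat g = mat g * (-1)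
  simp

theorem m0_mul_self : m0 p q * m0 p q = 1 := by
  apply Subtype.ext
  apply Units.ext
  change (-1 : Mat p q) * (-1) = 1
  simp

section Parabolic

variable (p q) [NeZero p] [NeZero q]

/-- The index of the first coordinate `x₁`. -/
def first : Fin p ⊕ Fin q := Sum.inl 0

/-- The index of the last coordinate `y_q`. -/
def last : Fin p ⊕ Fin q := Sum.inr ⊤

/-- The base point `ξ° = ᵗ(1, 0, …, 0, 1)` of the light cone. -/
def base : cone p q :=
  ⟨Pi.single (first p q) 1 + Pi.single (last p q) 1, by
    refine ⟨?_, ?_⟩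
    · simp [normX, normY, first, last, Pi.single_apply, ite_pow]
    · intro h
      have := congrFun (show (Pi.single (first p q) 1 + Pi.single (last p q) 1 : Space p q) = 0
        from h) (first p q)
      simp [first, last] at this⟩

/-- `E = E_{1,p+q} + E_{p+q,1} ∈ 𝔤₀`. -/
def E : Mat p q :=
  Matrix.single (first p q) (last p q) 1 + Matrix.single (last p q) (first p q) 1

theorem smul_E_mem (t : ℝ) : t • E p q ∈ lieAlg p q := by
  have h : (E p q)ᵀ * Ipq p q + Ipq p q * E p q = 0 := by
    unfold Ipq LieAlgebra.Orthogonal.indefiniteDiagonal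
    ext i j
    rw [Matrix.add_apply, Matrix.mul_diagonal, Matrix.diagonal_mul]
    rcases i with i | i <;> rcases j with j | j <;>
      simp [E, first, last, Matrix.single_apply, and_comm]
    split_ifs <;> simp
  change (t • E p q)ᵀ * Ipq p q + Ipq p q * (t • E p q) = 0
  rw [Matrix.transpose_smul, smul_mul_assoc, mul_smul_comm, ← smul_add, h, smul_zero]

/-- The element `exp(t E)` of `A^max`. -/
def expE (t : ℝ) : G p q := expG (t • E p q) (smul_E_mem p q t)

/-- `N^max = exp(𝔫)`, where `𝔫 = {X ∈ 𝔤₀ : [E, X] = X}`. -/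
def Nmax : Set (G p q) :=
  {n | ∃ (X : Mat p q) (hX : X ∈ lieAlg p q), E p q * X - X * E p q = X ∧ n = expG X hX}

/-- `M₊^max ≃ O(p-1,q-1)`: the subgroup fixing the first and the last standard basis vector. -/
def Mplus : Subgroup (G p q) where
  carrier := {m | mat m *ᵥ Pi.single (first p q) 1 = Pi.single (first p q) 1 ∧
    mat m *ᵥ Pi.single (last p q) 1 = Pi.single (last p q) 1}
  one_mem' := by
    have h1 : mat (1 : G p q) = 1 := rfl
    simp only [Set.mem_ofPred_eq, h1, Matrix.one_mulVec, and_self]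
  mul_mem' := by
    rintro a b ⟨ha1, ha2⟩ ⟨hb1, hb2⟩
    have hab : mat (a * b) = mat a * mat b := rfl
    refine ⟨?_, ?_⟩
    · rw [hab, ← Matrix.mulVec_mulVec, hb1, ha1]
    · rw [hab, ← Matrix.mulVec_mulVec, hb2, ha2]
  inv_mem' := by
    rintro a ⟨ha1, ha2⟩
    refine ⟨?_, ?_⟩
    · conv_lhs => rw [← ha1]
      rw [Matrix.mulVec_mulVec, mat_inv_mul, Matrix.one_mulVec]
    · conv_lhs => rw [← ha2]
      rw [Matrix.mulVec_mulVec, mat_inv_mul, Matrix.one_mulVec]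

/-- `M^max`: the subgroup generated by `M₊^max` and `m₀`. -/
def Mmax : Subgroup (G p q) := Subgroup.closure (Mplus p q ∪ {m0 p q})

variable {p q}

theorem m0_not_mem : m0 p q ∉ Mplus p q := by
  intro h
  have h1 : (-1 : Mat p q) *ᵥ Pi.single (first p q) 1 = Pi.single (first p q) 1 := h.1
  have h2 := congrFun h1 (first p q)
  simp only [Matrix.neg_mulVec, Matrix.one_mulVec, Pi.neg_apply, Pi.single_eq_same] at h2
  norm_num at h2

theorem Mmax_cases {m : G p q} (hm : m ∈ Mmax p q) :
    m ∈ Mplus p q ∨ m0 p q * m ∈ Mplus p q := by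
  induction hm using Subgroup.closure_induction with
  | mem x hx =>
    rcases hx with hx | hx
    · exact Or.inl hx
    · right
      rw [show x = m0 p q from hx, m0_mul_self]
      exact one_mem _
  | one => exact Or.inl (one_mem _)
  | mul a b _ _ ha hb =>
    rcases ha with ha | ha <;> rcases hb with hb | hb
    · exact Or.inl (mul_mem ha hb)
    · right
      rw [← mul_assoc, m0_comm, mul_assoc]
      exact mul_mem ha hb
    · right
      rw [← mul_assoc]
      exact mul_mem ha hb
    · left
      have := mul_mem ha hb
      rwa [m0_comm a, mul_assoc, ← mul_assoc (m0 p q) (m0 p q), m0_mul_self, one_mul] at this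
  | inv a _ ha =>
    rcases ha with ha | ha
    · exact Or.inl (inv_mem ha)
    · right
      have := inv_mem ha
      rwa [mul_inv_rev, inv_eq_of_mul_eq_one_left m0_mul_self, ← m0_comm] at this

open Classical in
/-- The character `χ_ε : M^max → M^max / M₊^max ≃ {1, m₀} → {±1}` with `χ_ε(m₀) = ε`. -/
def chi (ε : ℤˣ) : Mmax p q →* ℤˣ where
  toFun m := if (m : G p q) ∈ Mplus p q then 1 else ε
  map_one' := by simp [one_mem]
  map_mul' a b := by
    have key : ∀ {x y : G p q}, m0 p q * x ∈ Mplus p q → m0 p q * y ∈ Mplus p q →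
        x * y ∈ Mplus p q := by
      intro x y hx hy
      have := mul_mem hx hy
      rwa [m0_comm x, mul_assoc, ← mul_assoc (m0 p q) (m0 p q), m0_mul_self, one_mul] at this
    by_cases ha : (a : G p q) ∈ Mplus p q <;> by_cases hb : (b : G p q) ∈ Mplus p q
    · simp [ha, hb, mul_mem]
    · simp [ha, hb, Subgroup.mul_mem_cancel_left]
    · simp [ha, hb, Subgroup.mul_mem_cancel_right]
    · have := key ((Mmax_cases a.2).resolve_left ha) ((Mmax_cases b.2).resolve_left hb)
      simp [ha, hb, this]

variable (p q) in
/-- `ρ = (p + q - 2)/2`. -/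
def rho : ℂ := ((p : ℂ) + q - 2) / 2

variable (p q) in
/-- The `C^∞`-valued degenerate principal series `C^∞-Ind_{P^max}^G(χ_ε ⊗ ℂ_λ)`, where
`P^max = M^max A^max N^max`: the smooth functions on `G` with
`f(g m a n) = χ_ε(m⁻¹) a^{-(λ+ρ)} f(g)`; here `a^μ = e^{tμ}` for `a = exp(t E)`. -/
def Ind (lam : ℂ) (ε : ℤˣ) : Submodule ℂ (G p q → ℂ) where
  carrier := {f | f ∈ SmoothG p q ∧
    ∀ (g : G p q) (m : Mmax p q) (t : ℝ), ∀ n ∈ Nmax p q,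
      f (g * m * expE p q t * n) =
        ((chi ε m⁻¹ : ℤ) : ℂ) * Complex.exp (t * -(lam + rho p q)) * f g}
  zero_mem' := ⟨Submodule.zero_mem _, by simp⟩
  add_mem' := by
    rintro f k ⟨h1, h2⟩ ⟨k1, k2⟩
    refine ⟨Submodule.add_mem _ h1 k1, fun g m t n hn => ?_⟩
    simp only [Pi.add_apply, h2 g m t n hn, k2 g m t n hn, mul_add]
  smul_mem' := by
    rintro c f ⟨h1, h2⟩
    refine ⟨Submodule.smul_mem _ c h1, fun g m t n hn => ?_⟩
    simp only [Pi.smul_apply, smul_eq_mul, h2 g m t n hn]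
    ring

theorem translate_mem_Ind {lam : ℂ} {ε : ℤˣ} (h : G p q) {f : G p q → ℂ}
    (hf : f ∈ Ind p q lam ε) : (fun g => f (h * g)) ∈ Ind p q lam ε := by
  refine ⟨?_, fun g m t n hn => ?_⟩
  · refine IsSmooth.comp (f := f) hf.1 (fun g => h * g)
      (fun v i j => ∑ k, mat h i k * v k j)
      (fun g => ⟨Set.univ, isOpen_univ, trivial, ContDiff.contDiffOn ?_⟩) (fun g => ?_)
    · fun_prop
    · funext i j
      change (mat h * mat g) i j = _
      rw [Matrix.mul_apply]
      rfl
  · have := hf.2 (h * g) m t n hn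
    simpa only [mul_assoc] using this

variable (p q) in
/-- The representation of `G` on the degenerate principal series by left translations. -/
def indRep (lam : ℂ) (ε : ℤˣ) : Representation ℂ (G p q) (Ind p q lam ε) where
  toFun h :=
    { toFun := fun f => ⟨fun g => (f : G p q → ℂ) (h⁻¹ * g), translate_mem_Ind h⁻¹ f.2⟩
      map_add' := fun _ _ => rfl
      map_smul' := fun _ _ => rfl }
  map_one' := by
    refine LinearMap.ext fun f => Subtype.ext (funext fun g => ?_)
    simp
  map_mul' g h := by
    refine LinearMap.ext fun f => Subtype.ext (funext fun x => ?_)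
    simp [mul_assoc]

end Parabolic

end OPQ

end

/-! Put `a = -(p+q-4)/2`. Under homogeneous extension of degree `a` from `M` to the cone, the
twisted action `ϖ` becomes plain left translation. So three facts are needed: `V` is `G`-stable, its
elements have parity `(-1)^((p-q)/2)`, and homogeneous functions on the cone are the induced
functions on `G`.

Stability. Near `M`, split the ultrahyperbolic operator `Δ_x - Δ_y` in polar coordinates in `x` and
in `y`. For a function homogeneous of degree `a`, Euler's relation and its derivative reduce the
radial terms to `(p-q)/2` times the Euler field, hence to a constant. This constant is exactly the
curvature term, so on `M` the result is the Yamabe operator of the restriction (`box_eq_yamabe`).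
Only homogeneity and the values on `M` matter, so any degree `a` extension may be used. As `G`
preserves the ultrahyperbolic operator up to the substitution, the kernel is stable (`yamabe_varpi`,
`varpi_mem_V`).

Parity. On a product of spherical harmonics of degrees `a`, `b` (now degrees, not the exponent
above) the Yamabe equation reads `(2a+p-2)² = (2b+q-2)²`, which forces `b - a = (p-q)/2`. Instead of
expanding in harmonics, the part of a solution with the wrong parity is extended radially, cut off
to a compactly supported function `W`, and tested against products of `|x|²`, `|y|²` and powers of
two linear forms. Where parity does not already make the integral vanish, the symmetry of the
angular operators expresses a nonzero multiple of it through integrals of lower degree, so induction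
applies (`integral_mul_testFn_eq_zero`). Hence all moments of `W` vanish, its Fourier transform is
zero, and `W = 0` (`eq_zero_of_angular_eq`). This gives `apply_negM`.

Induced picture. Reflections in differences of isotropic vectors make `G` transitive on the cone
(`exists_smul_eq`). The stabilizer of `ξ°` is `M₊N` (`exists_eq_mul_of_smul_base`), while `exp(tE)`
dilates `ξ°` by `e^t` and `m₀` negates it; the equivariance conditions therefore become homogeneity
and parity, with `-(-1+ρ) = a`. The same reflections give smooth local sections of the orbit map, so
smoothness descends from `G` to the cone (`isSmooth_descend`). -/

noncomputable section

namespace OPQ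

/-! ### Second derivatives along rotations and the polar form of the Laplacian -/

section SecondDerivatives

/-! ### Second derivatives along curves -/

section Calculus

variable {E F : Type*} [NormedAddCommGroup E] [NormedSpace ℝ E] [NormedAddCommGroup F]
  [NormedSpace ℝ F]

/-- The second derivative of a function along a curve. -/
theorem iteratedDeriv_two_comp_curve {f : E → F} {γ γ' : ℝ → E} {γ'' : E}
    (hf : ContDiffAt ℝ 2 f (γ 0)) (h1 : ∀ t, HasDerivAt γ (γ' t) t) (h2 : HasDerivAt γ' γ'' 0) :
    iteratedDeriv 2 (fun t => f (γ t)) 0 =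
      fderiv ℝ (fderiv ℝ f) (γ 0) (γ' 0) (γ' 0) + fderiv ℝ f (γ 0) γ'' := by
  have hev : ∀ᶠ t in nhds (0 : ℝ), DifferentiableAt ℝ f (γ t) := by
    have h := hf.eventually (by decide)
    filter_upwards [(h1 0).continuousAt.eventually h] with t ht
    exact ht.differentiableAt (by decide)
  have hd : deriv (fun t => f (γ t)) =ᶠ[nhds 0] fun t => fderiv ℝ f (γ t) (γ' t) := by
    filter_upwards [hev] with t ht
    exact (ht.hasFDerivAt.comp_hasDerivAt t (h1 t)).deriv
  rw [iteratedDeriv_succ, iteratedDeriv_one, hd.deriv_eq]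
  have hdf : DifferentiableAt ℝ (fderiv ℝ f) (γ 0) :=
    (hf.fderiv_right (m := 1) (by norm_num [one_add_one_eq_two])).differentiableAt (by decide)
  exact ((hdf.hasFDerivAt.comp_hasDerivAt (0 : ℝ) (h1 0)).clm_apply h2).deriv

theorem iteratedDeriv_two_congr {f g : ℝ → F} (h : f =ᶠ[nhds 0] g) :
    iteratedDeriv 2 f 0 = iteratedDeriv 2 g 0 := by
  simp only [iteratedDeriv_succ, iteratedDeriv_zero]
  exact h.deriv.deriv_eq

theorem iteratedDeriv_two_line {f : E → F} {z : E}
    (hf : ContDiffAt ℝ 2 f z) (v : E) :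
    iteratedDeriv 2 (fun t : ℝ => f (z + t • v)) 0 = fderiv ℝ (fderiv ℝ f) z v v := by
  have h := iteratedDeriv_two_comp_curve (f := f) (γ := fun t : ℝ => z + t • v)
    (γ' := fun _ => v) (γ'' := 0) (by simpa using hf)
    (fun t => by simpa using ((hasDerivAt_id t).smul_const v).const_add z)
    (hasDerivAt_const _ _)
  simpa using h

end Calculus

/-! ### Rotations in coordinate planes -/

section Rotation

variable {ι : Type*} [DecidableEq ι]

/-- The rotation by the angle `t` in the plane spanned by the `i`-th and the `j`-th coordinate
vector, where `i ≠ j`. -/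
def rot (i j : ι) (t : ℝ) (z : ι → ℝ) : ι → ℝ :=
  z + (Real.cos t - 1) • (z i • Pi.single i 1 + z j • Pi.single j 1 : ι → ℝ) +
    Real.sin t • (z i • Pi.single j 1 - z j • Pi.single i 1 : ι → ℝ)

/-- The derivative of the rotation of the coordinate plane of `i` and `j`. -/
def rotDeriv (i j : ι) (t : ℝ) (z : ι → ℝ) : ι → ℝ :=
  (-Real.sin t) • (z i • Pi.single i 1 + z j • Pi.single j 1 : ι → ℝ) +
    Real.cos t • (z i • Pi.single j 1 - z j • Pi.single i 1 : ι → ℝ)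

theorem rot_zero (i j : ι) (z : ι → ℝ) : rot i j 0 z = z := by simp [rot]

theorem rotDeriv_zero (i j : ι) (z : ι → ℝ) :
    rotDeriv i j 0 z = z i • Pi.single j 1 - z j • Pi.single i 1 := by simp [rotDeriv]

theorem rot_apply_of_ne {i j k : ι} (hi : k ≠ i) (hj : k ≠ j) (t : ℝ) (z : ι → ℝ) :
    rot i j t z k = z k := by
  simp [rot, hi, hj]

theorem rot_apply_left {i j : ι} (h : i ≠ j) (t : ℝ) (z : ι → ℝ) :
    rot i j t z i = Real.cos t * z i - Real.sin t * z j := by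
  simp [rot, h]; ring

theorem rot_apply_right {i j : ι} (h : i ≠ j) (t : ℝ) (z : ι → ℝ) :
    rot i j t z j = Real.cos t * z j + Real.sin t * z i := by
  simp [rot, h.symm]; ring

theorem hasDerivAt_rot [Fintype ι] (i j : ι) (z : ι → ℝ) (t : ℝ) :
    HasDerivAt (fun t => rot i j t z) (rotDeriv i j t z) t := by
  have h1 := ((Real.hasDerivAt_cos t).sub_const 1).smul_const
    (z i • Pi.single i 1 + z j • Pi.single j 1 : ι → ℝ)
  have h2 := (Real.hasDerivAt_sin t).smul_const
    (z i • Pi.single j 1 - z j • Pi.single i 1 : ι → ℝ)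
  exact (h1.const_add z).add h2

theorem hasDerivAt_rotDeriv [Fintype ι] (i j : ι) (z : ι → ℝ) :
    HasDerivAt (fun t => rotDeriv i j t z)
      (-(z i • Pi.single i 1 + z j • Pi.single j 1 : ι → ℝ)) 0 := by
  have h1 := (Real.hasDerivAt_sin 0).neg.smul_const
    (z i • Pi.single i 1 + z j • Pi.single j 1 : ι → ℝ)
  have h2 := (Real.hasDerivAt_cos 0).smul_const
    (z i • Pi.single j 1 - z j • Pi.single i 1 : ι → ℝ)
  refine (h1.add h2).congr_deriv ?_
  simp only [Real.cos_zero, Real.sin_zero, neg_smul, one_smul, zero_smul, neg_zero, add_zero]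

/-- The second derivative of a function in the direction of the rotations of the coordinate plane
of `i` and `j`. -/
def rot2 (f : (ι → ℝ) → ℂ) (i j : ι) (z : ι → ℝ) : ℂ :=
  iteratedDeriv 2 (fun t => f (rot i j t z)) 0

theorem rot2_eq [Fintype ι] {f : (ι → ℝ) → ℂ} {z : ι → ℝ} (hf : ContDiffAt ℝ 2 f z) (i j : ι) :
    rot2 f i j z =
      fderiv ℝ (fderiv ℝ f) z (z i • Pi.single j 1 - z j • Pi.single i 1)
        (z i • Pi.single j 1 - z j • Pi.single i 1) -
      fderiv ℝ f z (z i • Pi.single i 1 + z j • Pi.single j 1) := by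
  have h0 := rot_zero i j z
  have := iteratedDeriv_two_comp_curve (f := f) (γ := fun t => rot i j t z)
    (by simpa only [h0] using hf) (hasDerivAt_rot i j z) (hasDerivAt_rotDeriv i j z)
  simp only [h0, rotDeriv_zero] at this
  rw [rot2, this, map_neg, ← sub_eq_add_neg]

variable {κ : Type*} [Fintype κ] [DecidableEq κ]

/-- The component of `z` in the coordinates `e i`. -/
def block (e : κ → ι) (z : ι → ℝ) : ι → ℝ := ∑ i, z (e i) • Pi.single (e i) 1

/-- The sum of the squares of the angular momentum operators in the coordinates `e i`; it is
the Laplace-Beltrami operator of the spheres around `0` in these coordinates. -/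
def angular (e : κ → ι) (f : (ι → ℝ) → ℂ) (z : ι → ℝ) : ℂ :=
  (1 / 2 : ℂ) * ∑ i, ∑ j, if i = j then 0 else rot2 f (e i) (e j) z

/-- The decomposition of the Euclidean Laplacian in polar coordinates. -/
theorem angular_eq [Fintype ι] {f : (ι → ℝ) → ℂ} {z : ι → ℝ} (hf : ContDiffAt ℝ 2 f z)
    (e : κ → ι) :
    angular e f z =
      ((∑ i, z (e i) ^ 2 : ℝ) : ℂ) *
          ∑ i, fderiv ℝ (fderiv ℝ f) z (Pi.single (e i) 1) (Pi.single (e i) 1) -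
        fderiv ℝ (fderiv ℝ f) z (block e z) (block e z) -
        ((Fintype.card κ : ℂ) - 1) * fderiv ℝ f z (block e z) := by
  set H := fderiv ℝ (fderiv ℝ f) z
  set D := fderiv ℝ f z
  set s : κ → ι → ℝ := fun i => Pi.single (e i) 1
  -- The off-diagonal formula, evaluated at `i = j`, would give `-2 z_i D(s i)` instead of `0`. The
  -- last term corrects this, and is the source of the `-1` in `card κ - 1`.
  have h1 : ∀ i j, (if i = j then 0 else rot2 f (e i) (e j) z) =
      ((z (e i) : ℂ) ^ 2 * H (s j) (s j) - z (e i) * z (e j) * H (s j) (s i) -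
        z (e i) * z (e j) * H (s i) (s j) + (z (e j) : ℂ) ^ 2 * H (s i) (s i)) -
      (z (e i) * D (s i) + z (e j) * D (s j)) +
      (if i = j then 2 * z (e i) * D (s i) else 0) := by
    intro i j
    split_ifs with h
    · subst h; ring
    · rw [rot2_eq hf]
      simp only [map_sub, map_smul, map_add, sub_apply,
        smul_apply, Complex.real_smul]
      ring
  have h3 : D (block e z) = ∑ i, z (e i) * D (s i) := by
    simp only [block, map_sum, map_smul, Complex.real_smul, s]
  -- Both orders of the indices occur in the sum, so relabelling suffices and no symmetry of `H` is
  -- used.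
  have h4 : ∑ i, ∑ j, (z (e i) : ℂ) * z (e j) * H (s j) (s i) =
      ∑ i, ∑ j, z (e i) * z (e j) * H (s i) (s j) := by
    rw [Finset.sum_comm]
    refine Finset.sum_congr rfl fun i _ => Finset.sum_congr rfl fun j _ => ?_
    ring
  have h2 : H (block e z) (block e z) = ∑ i, ∑ j, z (e i) * z (e j) * H (s i) (s j) := by
    rw [← h4]
    simp only [block, map_sum, map_smul, sum_apply,
      smul_apply, Complex.real_smul, Finset.mul_sum, s]
    refine Finset.sum_congr rfl fun i _ => Finset.sum_congr rfl fun j _ => ?_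
    ring
  have h5 : ∑ i, ∑ j, (z (e i) : ℂ) ^ 2 * H (s j) (s j) =
      ((∑ i, z (e i) ^ 2 : ℝ) : ℂ) * ∑ i, H (s i) (s i) := by
    push_cast
    rw [Finset.sum_mul_sum]
  have h6 : ∑ i, ∑ j, (z (e j) : ℂ) ^ 2 * H (s i) (s i) =
      ((∑ i, z (e i) ^ 2 : ℝ) : ℂ) * ∑ i, H (s i) (s i) := by
    rw [← h5, Finset.sum_comm]
  rw [angular]
  simp only [h1, Finset.sum_add_distrib, Finset.sum_sub_distrib, Finset.sum_ite_eq,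
    Finset.mem_univ, if_true, h5, h6, h4, ← h2, h3, Finset.sum_const, Finset.card_univ,
    nsmul_eq_mul]
  simp only [mul_assoc, ← Finset.mul_sum]
  ring

/-- Only values along rotation orbits enter. Rotations of `x` or of `y` preserve `M`, so this allows
one extension of a function on `M` to be exchanged for another, or a point to be rescaled. -/
theorem angular_congr {f g : (ι → ℝ) → ℂ} {e : κ → ι} {z w : ι → ℝ}
    (h : ∀ i j, i ≠ j → (fun t => f (rot (e i) (e j) t z)) =ᶠ[nhds 0]
      fun t => g (rot (e i) (e j) t w)) : angular e f z = angular e g w := by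
  unfold angular
  congr 1
  refine Finset.sum_congr rfl fun i _ => Finset.sum_congr rfl fun j _ => ?_
  split_ifs with hij
  · rfl
  · exact iteratedDeriv_two_congr (h i j hij)

end Rotation

end SecondDerivatives

/-! ### The Yamabe operator as the restriction of the ultrahyperbolic operator -/

section AngularOperators

/-! ### Rotations of the two factors of `ℝ^p × ℝ^q` -/

section RotationSums

theorem rot_apply_of_not_mem {ι κ : Type*} [DecidableEq ι] {e : κ → ι} {k : ι}
    (hk : ∀ i, k ≠ e i) (i j : κ) (t : ℝ) (z : ι → ℝ) : rot (e i) (e j) t z k = z k :=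
  rot_apply_of_ne (hk i) (hk j) t z

variable {ι κ : Type*} [DecidableEq ι] [Fintype κ] {e : κ → ι}

theorem sum_rot_sq (he : Function.Injective e) {i j : κ} (hij : i ≠ j) (t : ℝ) (z : ι → ℝ) :
    ∑ k, rot (e i) (e j) t z (e k) ^ 2 = ∑ k, z (e k) ^ 2 := by
  have hne : e i ≠ e j := he.ne hij
  rw [← sub_eq_zero, ← Finset.sum_sub_distrib, Fintype.sum_eq_add i j hij]
  · rw [rot_apply_left hne, rot_apply_right hne]
    linear_combination (z (e i) ^ 2 + z (e j) ^ 2) * Real.sin_sq_add_cos_sq t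
  · rintro k ⟨h1, h2⟩
    rw [rot_apply_of_ne (he.ne h1) (he.ne h2), sub_self]

end RotationSums

variable {p q : ℕ}

theorem normX_rot_inl {i j : Fin p} (hij : i ≠ j) (t : ℝ) (z : Space p q) :
    normX (rot (Sum.inl i) (Sum.inl j) t z) = normX z := by
  unfold normX
  rw [sum_rot_sq Sum.inl_injective hij]

theorem normY_rot_inl (i j : Fin p) (t : ℝ) (z : Space p q) :
    normY (rot (Sum.inl i) (Sum.inl j) t z) = normY z := by
  unfold normY
  simp only [rot_apply_of_not_mem (e := (Sum.inl : Fin p → Fin p ⊕ Fin q))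
    (fun _ => Sum.inr_ne_inl)]

theorem normY_rot_inr {i j : Fin q} (hij : i ≠ j) (t : ℝ) (z : Space p q) :
    normY (rot (Sum.inr i) (Sum.inr j) t z) = normY z := by
  unfold normY
  rw [sum_rot_sq Sum.inr_injective hij]

theorem normX_rot_inr (i j : Fin q) (t : ℝ) (z : Space p q) :
    normX (rot (Sum.inr i) (Sum.inr j) t z) = normX z := by
  unfold normX
  simp only [rot_apply_of_not_mem (e := (Sum.inr : Fin q → Fin p ⊕ Fin q))
    (fun _ => Sum.inl_ne_inr)]

theorem block_inl (z : Space p q) : block Sum.inl z =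
    Sum.elim (fun i => z (Sum.inl i)) (fun _ => 0) := by
  funext k
  cases k <;> simp [block, Pi.single_apply]

theorem block_inr (z : Space p q) : block Sum.inr z =
    Sum.elim (fun _ => 0) (fun j => z (Sum.inr j)) := by
  funext k
  cases k <;> simp [block, Pi.single_apply]

theorem block_add_block (z : Space p q) : block Sum.inl z + block Sum.inr z = z := by
  rw [block_inl, block_inr]
  funext k
  cases k <;> simp

/-! ### The Laplace-Beltrami operators as angular operators -/

theorem radial_of_mem {v : Space p q} (hv : v ∈ spheres p q) : radial v = v :=
  congrArg Subtype.val (proj_toCone ⟨v, hv⟩)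

theorem extend_of_mem (f : spheres p q → ℂ) (z : spheres p q) : extend f z = f z := by
  have h : radial (z : Space p q) = z := radial_of_mem z.2
  rw [extend, dif_pos (by rw [h]; exact z.2)]
  congr 1
  exact Subtype.ext h

theorem extend_congr (f : spheres p q → ℂ) {v w : Space p q} (h : radial v = radial w) :
    extend f v = extend f w := by
  unfold extend
  split_ifs with h1 h2 h2
  · congr 1
    exact Subtype.ext h
  · rw [h] at h1
    exact absurd h1 h2
  · rw [h] at h1
    exact absurd h2 h1
  · rfl

theorem sum_sq_inl (z : spheres p q) : ∑ i, (z : Space p q) (Sum.inl i) ^ 2 = 1 := by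
  have := z.2.1
  rwa [normX, Real.sqrt_eq_one] at this

theorem sum_sq_inr (z : spheres p q) : ∑ i, (z : Space p q) (Sum.inr i) ^ 2 = 1 := by
  have := z.2.2
  rwa [normY, Real.sqrt_eq_one] at this

theorem normX_eq_of_inl {v w : Space p q} (h : ∀ i, v (Sum.inl i) = w (Sum.inl i)) :
    normX v = normX w := by simp only [normX, h]

theorem normY_eq_of_inr {v w : Space p q} (h : ∀ i, v (Sum.inr i) = w (Sum.inr i)) :
    normY v = normY w := by simp only [normY, h]

/-- Rescaling both components by positive factors does not change the radial projection. -/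
theorem radial_eq_of_scale {v w : Space p q} {s t : ℝ} (hs : 0 < s) (ht : 0 < t)
    (h1 : ∀ i, v (Sum.inl i) = s * w (Sum.inl i)) (h2 : ∀ j, v (Sum.inr j) = t * w (Sum.inr j)) :
    radial v = radial w := by
  have hX : normX v = s * normX w := by
    rw [← normX_smul hs.le]; exact normX_eq_of_inl h1
  have hY : normY v = t * normY w := by
    rw [← normY_smul ht.le]; exact normY_eq_of_inr h2
  funext k
  cases k with
  | inl i => simp only [radial, Sum.elim_inl, hX, h1, mul_div_mul_left _ _ hs.ne']
  | inr j => simp only [radial, Sum.elim_inr, hY, h2, mul_div_mul_left _ _ ht.ne']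

/-- Derivatives in a direction in which a function is locally constant. -/
theorem fderiv_eq_zero_of_line {E F : Type*} [NormedAddCommGroup E] [NormedSpace ℝ E]
    [NormedAddCommGroup F] [NormedSpace ℝ F] {f : E → F} {z v : E} (hf : ContDiffAt ℝ 2 f z)
    (h : ∀ᶠ t : ℝ in nhds 0, f (z + t • v) = f z) :
    fderiv ℝ f z v = 0 ∧ fderiv ℝ (fderiv ℝ f) z v v = 0 := by
  constructor
  · have h1 : HasDerivAt (fun t : ℝ => z + t • v) v 0 := by
      simpa using ((hasDerivAt_id (0 : ℝ)).smul_const v).const_add z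
    have h2 : HasFDerivAt f (fderiv ℝ f z) (z + (0 : ℝ) • v) := by
      simpa using (hf.differentiableAt (by decide)).hasFDerivAt
    have h3 := (h2.comp_hasDerivAt (0 : ℝ) h1).deriv
    rw [← h3]
    have h4 : (f ∘ fun t : ℝ => z + t • v) =ᶠ[nhds 0] fun _ => f z := h
    rw [h4.deriv_eq, deriv_const]
  · rw [← iteratedDeriv_two_line hf, iteratedDeriv_two_congr (g := fun _ => f z) h]
    simp [iteratedDeriv_const]

theorem eventually_one_add_pos : ∀ᶠ t : ℝ in nhds 0, 0 < 1 + t := by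
  have h : Continuous fun t : ℝ => 1 + t := by fun_prop
  exact h.continuousAt.eventually_const_lt (by norm_num)

theorem contDiffAt_two_extend {f : spheres p q → ℂ} (hf : f ∈ SmoothM p q) (z : spheres p q) :
    ContDiffAt ℝ 2 (extend f) (z : Space p q) :=
  (contDiffAt_extend hf z).of_le (WithTop.coe_le_coe.2 le_top)

/-- The extension is constant along the ray in the `x` direction, so both radial terms in the polar
form vanish, and `|x| = 1` on `M`. The angular form involves only values on `M`, unlike the
coordinate second derivatives. -/
theorem lapX_eq_angular {f : spheres p q → ℂ} (hf : f ∈ SmoothM p q) (z : spheres p q) :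
    lapX f z = angular Sum.inl (extend f) z := by
  have hw := contDiffAt_two_extend hf z
  obtain ⟨h1, h2⟩ := fderiv_eq_zero_of_line (v := block Sum.inl (z : Space p q)) hw (by
    filter_upwards [eventually_one_add_pos] with t ht
    refine extend_congr f (radial_eq_of_scale ht one_pos (fun i => ?_) (fun j => ?_))
    · simp [block_inl]; ring
    · simp [block_inl])
  rw [angular_eq hw, h1, h2, sum_sq_inl]
  simp [lapX, partial2, iteratedDeriv_two_line hw]

theorem lapY_eq_angular {f : spheres p q → ℂ} (hf : f ∈ SmoothM p q) (z : spheres p q) :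
    lapY f z = angular Sum.inr (extend f) z := by
  have hw := contDiffAt_two_extend hf z
  obtain ⟨h1, h2⟩ := fderiv_eq_zero_of_line (v := block Sum.inr (z : Space p q)) hw (by
    filter_upwards [eventually_one_add_pos] with t ht
    refine extend_congr f (radial_eq_of_scale one_pos ht (fun i => ?_) (fun j => ?_))
    · simp [block_inr]
    · simp [block_inr]; ring)
  rw [angular_eq hw, h1, h2, sum_sq_inr]
  simp [lapY, partial2, iteratedDeriv_two_line hw]

/-! ### The ultrahyperbolic operator and the Yamabe operator -/

/-- The ultrahyperbolic operator `∑ ∂²/∂x_i² - ∑ ∂²/∂y_j²`. -/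
def box (F : Space p q → ℂ) (z : Space p q) : ℂ :=
  ∑ i : Fin p, fderiv ℝ (fderiv ℝ F) z (Pi.single (Sum.inl i) 1) (Pi.single (Sum.inl i) 1) -
    ∑ j : Fin q, fderiv ℝ (fderiv ℝ F) z (Pi.single (Sum.inr j) 1) (Pi.single (Sum.inr j) 1)

variable (p q) in
/-- The zeroth order term of the Yamabe operator. -/
def yamabeConst : ℂ := ((p : ℂ) + q - 4) * ((p : ℂ) - q) / 4

/-- Since `(p-1)(p-2) - (q-1)(q-2) = (p-q)(p+q-3)`, the denominator cancels; it is nonzero because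
`p + q ≥ 4`. -/
theorem yamabe_apply (hp : 2 ≤ p) (hq : 2 ≤ q) (f : spheres p q → ℂ) (z : spheres p q) :
    yamabe f z = lapX f z - lapY f z - yamabeConst p q * f z := by
  have h : (p : ℂ) + q - 3 ≠ 0 := by
    have : ((p + q - 3 : ℕ) : ℂ) ≠ 0 := by exact_mod_cast (by omega : p + q - 3 ≠ 0)
    rwa [Nat.cast_sub (by omega), Nat.cast_add] at this
  rw [yamabe, yamabeConst]
  field_simp
  ring

/-- The Yamabe operator is the restriction to `M` of the ultrahyperbolic operator, applied to
any homogeneous extension of degree `-(p+q-4)/2`. -/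
theorem box_eq_yamabe (hp : 2 ≤ p) (hq : 2 ≤ q) {f : spheres p q → ℂ} (hf : f ∈ SmoothM p q)
    (z : spheres p q) {F : Space p q → ℂ} (hF : ContDiffAt ℝ 2 F (z : Space p q))
    (hE : ∀ᶠ v in nhds (z : Space p q), fderiv ℝ F v v = -(((p : ℂ) + q - 4) / 2) * F v)
    (hFf : ∀ w : spheres p q, F w = f w) : box F z = yamabe f z := by
  have hX : angular Sum.inl F (z : Space p q) = lapX f z := by
    rw [lapX_eq_angular hf]
    refine angular_congr fun i j hij => Filter.Eventually.of_forall fun t => ?_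
    have hm : rot (Sum.inl i) (Sum.inl j) t (z : Space p q) ∈ spheres p q :=
      ⟨(normX_rot_inl hij _ _).trans z.2.1, (normY_rot_inl _ _ _ _).trans z.2.2⟩
    exact (hFf ⟨_, hm⟩).trans (extend_of_mem f ⟨_, hm⟩).symm
  have hY : angular Sum.inr F (z : Space p q) = lapY f z := by
    rw [lapY_eq_angular hf]
    refine angular_congr fun i j hij => Filter.Eventually.of_forall fun t => ?_
    have hm : rot (Sum.inr i) (Sum.inr j) t (z : Space p q) ∈ spheres p q :=
      ⟨(normX_rot_inr _ _ _ _).trans z.2.1, (normY_rot_inr hij _ _).trans z.2.2⟩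
    exact (hFf ⟨_, hm⟩).trans (extend_of_mem f ⟨_, hm⟩).symm
  rw [angular_eq hF, sum_sq_inl] at hX
  rw [angular_eq hF, sum_sq_inr] at hY
  have hsymm : IsSymmSndFDerivAt ℝ F (z : Space p q) := hF.isSymmSndFDerivAt (by simp)
  have hd : DifferentiableAt ℝ F (z : Space p q) := hF.differentiableAt (by decide)
  have hdd : DifferentiableAt ℝ (fderiv ℝ F) (z : Space p q) :=
    (hF.fderiv_right (m := 1) (by norm_num [one_add_one_eq_two])).differentiableAt (by decide)
  -- The derivative of Euler's relation in the direction `v`. This is why the relation is required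
  -- in a neighbourhood and not only at `z`.
  have hE2 : ∀ v : Space p q, fderiv ℝ (fderiv ℝ F) z v z + fderiv ℝ F z v =
      -(((p : ℂ) + q - 4) / 2) * fderiv ℝ F z v := by
    intro v
    have h1 := hdd.hasFDerivAt.clm_apply (hasFDerivAt_id (z : Space p q))
    have h2 := hd.hasFDerivAt.const_mul (-(((p : ℂ) + q - 4) / 2))
    have h3 := (h2.congr_of_eventuallyEq hE).unique h1
    have h4 := congrArg (fun l => l v) h3
    simp at h4
    linear_combination -h4
  have hE1 := hE.self_of_nhds
  have hz := block_add_block (z : Space p q)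
  set x := block Sum.inl (z : Space p q)
  set y := block Sum.inr (z : Space p q)
  have e1 := hE2 x
  have e2 := hE2 y
  have e3 : fderiv ℝ F z x + fderiv ℝ F z y = -(((p : ℂ) + q - 4) / 2) * F z := by
    rw [← map_add, hz, hE1]
  have e4 := hsymm x y
  have e5 : ∀ v : Space p q, fderiv ℝ (fderiv ℝ F) z v z =
      fderiv ℝ (fderiv ℝ F) z v x + fderiv ℝ (fderiv ℝ F) z v y := by
    intro v
    rw [← map_add, hz]
  rw [e5] at e1 e2
  rw [yamabe_apply hp hq, ← hX, ← hY, ← hFf z, box, yamabeConst]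
  simp only [Fintype.card_fin]
  push_cast
  -- The mixed terms cancel by symmetry of the Hessian. For degree `d = -(p+q-4)/2`, the first
  -- derivatives along `x` and `y` are left with coefficients `d + p - 2` and `-(d + q - 2)`. Both
  -- equal `(p-q)/2`, precisely for this `d`, so Euler's relation `e3` finishes.
  linear_combination e1 - e2 - e4 + ((p : ℂ) - q) / 2 * e3

end AngularOperators

/-! ### Stability of the kernel of the Yamabe operator under `O(p,q)` -/

section ConformalInvariance

variable {p q : ℕ}

/-! ### Conformal invariance of the ultrahyperbolic operator -/

theorem box_eq_sum (F : Space p q → ℂ) (z : Space p q) :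
    box F z = ∑ k, ((Sum.elim (fun _ => 1) (fun _ => -1) k : ℝ) : ℂ) *
      fderiv ℝ (fderiv ℝ F) z (Pi.single k 1) (Pi.single k 1) := by
  simp [box, Fintype.sum_sum_type, sub_eq_add_neg]

/-- The operator contracts the Hessian with `I_{p,q}`, and the substitution `v ↦ A v` replaces this
tensor by `A I_{p,q} Aᵀ`. Similitudes are allowed because the group element will be rescaled so as
to send a chosen point of `M` back into `M`. -/
theorem box_const_mul_comp {A : Mat p q} {c : ℝ} (hA : A * Ipq p q * Aᵀ = c • Ipq p q) (b : ℂ)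
    {F : Space p q → ℂ} {z : Space p q} (hF : ContDiffAt ℝ 2 F (A *ᵥ z)) :
    box (fun v => b * F (A *ᵥ v)) z = b * (c * box F (A *ᵥ z)) := by
  set H := fderiv ℝ (fderiv ℝ F) (A *ᵥ z)
  have hFA : ContDiffAt ℝ 2 (fun v => b * F (A *ᵥ v)) z :=
    contDiffAt_const.mul (hF.comp z
      (((contDiff_mulVec A).of_le (WithTop.coe_le_coe.2 le_top)).contDiffAt))
  have h1 : ∀ k, fderiv ℝ (fderiv ℝ fun v => b * F (A *ᵥ v)) z (Pi.single k 1)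
      (Pi.single k 1) = b * H (A *ᵥ Pi.single k 1) (A *ᵥ Pi.single k 1) := by
    intro k
    rw [← iteratedDeriv_two_line hFA, ← iteratedDeriv_two_line hF]
    simp only [Matrix.mulVec_add, Matrix.mulVec_smul, iteratedDeriv_succ, iteratedDeriv_zero,
      deriv_const_mul_field']
  have h2 : ∀ k, A *ᵥ Pi.single k 1 = ∑ i, A i k • (Pi.single i 1 : Space p q) := by
    intro k
    funext j
    simp [Pi.single_apply]
  have h3 : ∀ i j, ∑ k, ((Sum.elim (fun _ => 1) (fun _ => -1) k : ℝ) : ℂ) * (A i k * A j k) =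
      if i = j then ((c * Sum.elim (fun _ => 1) (fun _ => -1) i : ℝ) : ℂ) else 0 := by
    intro i j
    have h := congrFun (congrFun hA i) j
    unfold Ipq LieAlgebra.Orthogonal.indefiniteDiagonal at h
    rw [Matrix.mul_apply] at h
    simp only [Matrix.mul_diagonal, Matrix.smul_apply, Matrix.diagonal_apply,
      Matrix.transpose_apply, smul_eq_mul, mul_ite, mul_zero] at h
    have h' := congrArg (fun r : ℝ => (r : ℂ)) h
    simp only [Complex.ofReal_sum] at h'
    rw [show (if i = j then ((c * Sum.elim (fun _ => 1) (fun _ => -1) i : ℝ) : ℂ) else 0) =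
      (((if i = j then c * Sum.elim (fun _ => 1) (fun _ => -1) i else 0 : ℝ)) : ℂ) by
        split_ifs <;> simp, ← h']
    refine Finset.sum_congr rfl fun k _ => ?_
    push_cast
    ring
  rw [box_eq_sum, box_eq_sum]
  simp only [h1, h2, map_sum, map_smul, sum_apply, smul_apply, Complex.real_smul]
  calc _ = b * ∑ i, ∑ j, (∑ k, ((Sum.elim (fun _ => 1) (fun _ => -1) k : ℝ) : ℂ) *
        (A i k * A j k)) * H (Pi.single j 1) (Pi.single i 1) := by
        simp only [Finset.mul_sum, Finset.sum_mul]
        rw [Finset.sum_comm]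
        refine (Finset.sum_congr rfl fun i _ => ?_)
        rw [Finset.sum_comm]
        refine (Finset.sum_congr rfl fun j _ => Finset.sum_congr rfl fun k _ => ?_)
        ring
    _ = _ := by
        simp only [h3, ite_mul, zero_mul, Finset.sum_ite_eq, Finset.mem_univ, if_true]
        congr 1
        rw [Finset.mul_sum]
        refine Finset.sum_congr rfl fun i _ => ?_
        push_cast
        ring

theorem Ipq_mul_self : Ipq p q * Ipq p q = 1 := by
  unfold Ipq LieAlgebra.Orthogonal.indefiniteDiagonal
  rw [Matrix.diagonal_mul_diagonal, ← Matrix.diagonal_one]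
  congr 1
  funext k
  cases k <;> simp

/-- Membership in `G` gives the transposed identity. It exhibits `I gᵀ I` as a left inverse of `g`,
which for square matrices is also a right inverse. -/
theorem mat_mul_Ipq_mul_transpose (g : G p q) : mat g * Ipq p q * (mat g)ᵀ = Ipq p q := by
  have h : (mat g)ᵀ * Ipq p q * mat g = Ipq p q := g.2
  have h1 : (Ipq p q * (mat g)ᵀ * Ipq p q) * mat g = 1 := by
    rw [mul_assoc, mul_assoc, ← mul_assoc (mat g)ᵀ, h, Ipq_mul_self]
  have h2 := mul_eq_one_comm.1 h1
  calc mat g * Ipq p q * (mat g)ᵀ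
      = mat g * (Ipq p q * (mat g)ᵀ * Ipq p q) * Ipq p q := by
        simp only [mul_assoc, Ipq_mul_self, mul_one]
    _ = _ := by rw [h2, one_mul]

/-! ### Homogeneous extensions -/

theorem contDiffAt_extend_of_pos {f : spheres p q → ℂ} (hf : f ∈ SmoothM p q) {v : Space p q}
    (hx : 0 < normX v) (hy : 0 < normY v) : ContDiffAt ℝ ∞ (extend f) v := by
  have h := contDiffAt_extend hf ⟨radial v, radial_mem hx hy⟩
  refine (ContDiffAt.comp v h (contDiffAt_radial hx hy)).congr_of_eventuallyEq ?_
  filter_upwards [continuous_normX.continuousAt.eventually_const_lt hx,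
    continuous_normY.continuousAt.eventually_const_lt hy] with w h1 h2
  exact extend_congr f (radial_of_mem (radial_mem h1 h2)).symm

/-- The extension of a function on `M` which is homogeneous of degree `a`. -/
def homExt (a : ℂ) (f : spheres p q → ℂ) (v : Space p q) : ℂ :=
  ((normX v : ℝ) : ℂ) ^ a * extend f v

theorem contDiffAt_normX_cpow (a : ℂ) {v : Space p q} (hx : 0 < normX v) :
    ContDiffAt ℝ ∞ (fun v : Space p q => ((normX v : ℝ) : ℂ) ^ a) v := by
  have h1 : ContDiffAt ℝ ∞ (fun v : Space p q => Real.log (normX v)) v :=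
    (contDiffOn_normX.contDiffAt
      ((isOpen_lt continuous_const continuous_normX).mem_nhds hx)).log hx.ne'
  have h2 : ContDiffAt ℝ ∞ (fun v : Space p q => Complex.exp ((Real.log (normX v) : ℂ) * a)) v :=
    ((Complex.ofRealCLM.contDiff.contDiffAt.comp v h1).mul contDiffAt_const).cexp
  refine h2.congr_of_eventuallyEq ?_
  filter_upwards [continuous_normX.continuousAt.eventually_const_lt hx] with w hw
  rw [Complex.cpow_def_of_ne_zero (by exact_mod_cast hw.ne'), ← Complex.ofReal_log hw.le]

theorem contDiffAt_homExt (a : ℂ) {f : spheres p q → ℂ} (hf : f ∈ SmoothM p q) {v : Space p q}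
    (hx : 0 < normX v) (hy : 0 < normY v) : ContDiffAt ℝ ∞ (homExt a f) v :=
  (contDiffAt_normX_cpow a hx).mul (contDiffAt_extend_of_pos hf hx hy)

theorem homExt_smul (a : ℂ) (f : spheres p q → ℂ) {t : ℝ} (ht : 0 < t) (v : Space p q) :
    homExt a f (t • v) = (t : ℂ) ^ a * homExt a f v := by
  rw [homExt, homExt, normX_smul ht.le, Complex.ofReal_mul,
    Complex.mul_cpow_ofReal_nonneg ht.le (normX_nonneg _),
    extend_congr f (radial_eq_of_scale ht ht (w := v) (fun _ => rfl) fun _ => rfl), mul_assoc]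

theorem homExt_cone (a : ℂ) (f : spheres p q → ℂ) (ξ : cone p q) :
    homExt a f ξ = ((nu (ξ : Space p q) : ℝ) : ℂ) ^ a * f (proj ξ) := by
  have h : radial (ξ : Space p q) ∈ spheres p q := (proj ξ).2
  rw [homExt, extend, dif_pos h]
  rfl

/-- Euler's relation. -/
theorem fderiv_self_of_homogeneous {E : Type*} [NormedAddCommGroup E] [NormedSpace ℝ E]
    {F : E → ℂ} {a : ℂ} {v : E} (hF : DifferentiableAt ℝ F v)
    (h : ∀ t : ℝ, 0 < t → F (t • v) = (t : ℂ) ^ a * F v) : fderiv ℝ F v v = a * F v := by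
  have h1 : HasDerivAt (fun t : ℝ => t • v) v 1 := by
    simpa using (hasDerivAt_id (1 : ℝ)).smul_const v
  have h2 : HasFDerivAt F (fderiv ℝ F v) ((1 : ℝ) • v) := by simpa using hF.hasFDerivAt
  have h3 := h2.comp_hasDerivAt (1 : ℝ) h1
  have h4 : HasDerivAt (fun t : ℝ => (t : ℂ) ^ a * F v) (a * F v) 1 := by
    have h5 : HasDerivAt (fun t : ℂ => t ^ a) a ((1 : ℝ) : ℂ) := by
      simpa using (hasDerivAt_id (1 : ℂ)).cpow_const (c := a) (by simp)
    exact h5.comp_ofReal.mul_const _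
  refine h3.unique (h4.congr_of_eventuallyEq ?_)
  filter_upwards [lt_mem_nhds one_pos] with t ht using h t ht

/-! ### The kernel of the Yamabe operator is stable under the conformal group -/

/-- The factor `ν(h·z)^{-λ}` is what the extension of degree `-λ` picks up when `h·z` is moved back
to `M`; on extensions the twisted action is a substitution. -/
theorem varpi_apply (lam : ℂ) (h : G p q) (f : SmoothM p q) (z : spheres p q) :
    (varpi p q lam h f : spheres p q → ℂ) z =
      homExt (-lam) (f : spheres p q → ℂ) (mat h⁻¹ *ᵥ (z : Space p q)) := by
  exact (homExt_cone (-lam) (f : spheres p q → ℂ) (h⁻¹ • toCone z)).symm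

theorem mulVec_toCone (h : G p q) (z : spheres p q) :
    (nuAct h z)⁻¹ • (mat h *ᵥ (z : Space p q)) = (L h z : Space p q) :=
  (radial_eq (h • toCone z)).symm

/-- The translate of a homogeneous extension of `f` is a homogeneous extension of `ϖ(h) f`. It need
not be the standard one away from the cone, but `box_eq_yamabe` accepts every extension. The power
of `ν` and the factor `ν⁻²` come from rescaling to a point of `M`. -/
theorem yamabe_varpi (hp : 2 ≤ p) (hq : 2 ≤ q) (h : G p q) (f : SmoothM p q)
    (z : spheres p q) :
    yamabe (varpi p q (((p : ℂ) + q - 4) / 2) h f : spheres p q → ℂ) z =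
      ((nuAct h⁻¹ z : ℝ) : ℂ) ^ (-(((p : ℂ) + q - 4) / 2)) * ((((nuAct h⁻¹ z)⁻¹ ^ 2 : ℝ) : ℂ) *
        yamabe (f : spheres p q → ℂ) (L h⁻¹ z)) := by
  set a : ℂ := -(((p : ℂ) + q - 4) / 2) with ha
  set t := nuAct h⁻¹ z
  have ht : 0 < t := nuAct_pos h⁻¹ z
  -- `box_eq_yamabe` applies only at points of `M`, so `h⁻¹` is divided by `ν(h⁻¹·z)`; then `A` maps
  -- `z` to `L h⁻¹ z`. Homogeneity restores the scalar as `t ^ a`.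
  set A : Mat p q := t⁻¹ • mat h⁻¹ with hAdef
  have hAz : A *ᵥ (z : Space p q) = L h⁻¹ z := by
    rw [hAdef, Matrix.smul_mulVec]
    exact mulVec_toCone h⁻¹ z
  have hA : A * Ipq p q * Aᵀ = (t⁻¹ ^ 2) • Ipq p q := by
    rw [hAdef, Matrix.transpose_smul, smul_mul_assoc, smul_mul_assoc, mul_smul_comm, smul_smul,
      mat_mul_Ipq_mul_transpose, pow_two]
  have hfun : ∀ v : Space p q, (t : ℂ) ^ a * homExt a (f : spheres p q → ℂ) (A *ᵥ v) =
      homExt a (f : spheres p q → ℂ) (mat h⁻¹ *ᵥ v) := by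
    intro v
    rw [hAdef, Matrix.smul_mulVec, ← homExt_smul a _ ht, smul_smul, mul_inv_cancel₀ ht.ne',
      one_smul]
  have hsm : ∀ w : spheres p q, ContDiffAt ℝ 2 (homExt a (f : spheres p q → ℂ)) (w : Space p q) :=
    fun w => (contDiffAt_homExt a f.2 (normX_pos_of_mem w) (normY_pos_of_mem w)).of_le
      (WithTop.coe_le_coe.2 le_top)
  have hF : ContDiffAt ℝ 2 (fun v => (t : ℂ) ^ a * homExt a (f : spheres p q → ℂ) (A *ᵥ v))
      (z : Space p q) := by
    have h := hsm (L h⁻¹ z)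
    rw [← hAz] at h
    exact contDiffAt_const.mul (h.comp (z : Space p q)
      ((contDiff_mulVec A).of_le (WithTop.coe_le_coe.2 le_top)).contDiffAt)
  have h1 := box_const_mul_comp (F := homExt a (f : spheres p q → ℂ)) (z := (z : Space p q)) hA
    ((t : ℂ) ^ a) (by rw [hAz]; exact hsm _)
  rw [box_eq_yamabe hp hq (varpi p q (((p : ℂ) + q - 4) / 2) h f).2 z hF ?_ ?_, hAz,
    box_eq_yamabe hp hq f.2 (L h⁻¹ z) (hsm _) ?_ ?_] at h1
  · exact h1
  · filter_upwards [(hsm (L h⁻¹ z)).eventually (by decide)] with v hv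
    exact fderiv_self_of_homogeneous (hv.differentiableAt (by decide))
      fun s hs => homExt_smul a _ hs v
  · intro w
    have := homExt_cone a (f : spheres p q → ℂ) (toCone w)
    rw [proj_toCone, show nu (toCone w : Space p q) = 1 from w.2.1] at this
    rw [Complex.ofReal_one, Complex.one_cpow, one_mul] at this
    exact this
  · filter_upwards [hF.eventually (by decide)] with v hv
    refine fderiv_self_of_homogeneous (hv.differentiableAt (by decide)) fun s hs => ?_
    rw [Matrix.mulVec_smul, homExt_smul a _ hs, mul_left_comm]
  · intro w
    rw [hfun, varpi_apply]

/-- `V^{p,q}` is stable under the action of `G`. -/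
theorem varpi_mem_V (hp : 2 ≤ p) (hq : 2 ≤ q) (h : G p q) {f : SmoothM p q} (hf : f ∈ V p q) :
    varpi p q (((p : ℂ) + q - 4) / 2) h f ∈ V p q := by
  intro z
  rw [yamabe_varpi hp hq, hf (L h⁻¹ z), mul_zero, mul_zero]

end ConformalInvariance

/-! ### Integration by parts for the angular operators, and their action on powers of linear forms
-/

section AngularSymmetry

/-! ### Symmetry of the angular operators -/

section Symmetry

open MeasureTheory

variable {ι : Type*} [Fintype ι]

theorem contDiff_fderiv_apply {f : (ι → ℝ) → ℂ} (hf : ContDiff ℝ ∞ f) (v : ι → ℝ) :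
    ContDiff ℝ ∞ fun z => fderiv ℝ f z v :=
  (hf.fderiv_right (m := ∞) (by simp)).clm_apply contDiff_const

theorem contDiff_coord (i : ι) : ContDiff ℝ ∞ fun z : ι → ℝ => (z i : ℂ) :=
  Complex.ofRealCLM.contDiff.comp (contDiff_apply ℝ ℝ i)

theorem integrable_mul_of_compact {f g : (ι → ℝ) → ℂ} (hf : Continuous f)
    (hc : HasCompactSupport f) (hg : Continuous g) : Integrable fun z => f z * g z :=
  (hf.mul hg).integrable_of_hasCompactSupport hc.mul_right

variable [DecidableEq ι]

/-- The first order differential operator `z_i ∂_j - z_j ∂_i`. -/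
def rotField (f : (ι → ℝ) → ℂ) (i j : ι) (z : ι → ℝ) : ℂ :=
  z i * fderiv ℝ f z (Pi.single j 1) - z j * fderiv ℝ f z (Pi.single i 1)

theorem hasCompactSupport_rotField {ι : Type*} [DecidableEq ι] {f : (ι → ℝ) → ℂ}
    (hf : HasCompactSupport f) (i j : ι) :
    HasCompactSupport (rotField f i j) := by
  refine (hf.fderiv ℝ).mono fun z hz h => hz ?_
  rw [rotField, h]
  simp

theorem contDiff_rotField {f : (ι → ℝ) → ℂ} (hf : ContDiff ℝ ∞ f) (i j : ι) :
    ContDiff ℝ ∞ (rotField f i j) :=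
  ((contDiff_coord i).mul (contDiff_fderiv_apply hf _)).sub
    ((contDiff_coord j).mul (contDiff_fderiv_apply hf _))

/-- The field `z_i ∂_j - z_j ∂_i` generates the rotations, so the second derivative along the
rotation is the square of the field. In this form integration by parts applies. -/
theorem rot2_eq_rotField {f : (ι → ℝ) → ℂ} (hf : ContDiff ℝ ∞ f) {i j : ι} (hij : i ≠ j)
    (z : ι → ℝ) : rot2 f i j z = rotField (rotField f i j) i j z := by
  have hd : DifferentiableAt ℝ (fderiv ℝ f) z :=
    (hf.fderiv_right (m := ∞) (by simp)).contDiffAt.differentiableAt (by simp)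
  have hk : ∀ k : ι, HasFDerivAt (fun z : ι → ℝ => (z k : ℂ))
      (Complex.ofRealCLM.comp (ContinuousLinearMap.proj k)) z := fun k =>
    (Complex.ofRealCLM.comp (ContinuousLinearMap.proj (R := ℝ) (φ := fun _ : ι => ℝ) k)).hasFDerivAt
  have h1 : ∀ k : ι, HasFDerivAt (fun z => fderiv ℝ f z (Pi.single k 1))
      ((fderiv ℝ (fderiv ℝ f) z).flip (Pi.single k 1)) z := fun k => by
    simpa using hd.hasFDerivAt.clm_apply (hasFDerivAt_const (Pi.single k 1 : ι → ℝ) z)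
  have h2 := (((hk i).mul (h1 j)).sub ((hk j).mul (h1 i))).fderiv
  rw [rot2_eq (hf.contDiffAt.of_le (WithTop.coe_le_coe.2 le_top))]
  rw [rotField]
  change _ = z i * fderiv ℝ ((fun z => (z i : ℂ) * fderiv ℝ f z (Pi.single j 1)) -
      fun z => (z j : ℂ) * fderiv ℝ f z (Pi.single i 1)) z (Pi.single j 1) -
    z j * fderiv ℝ ((fun z => (z i : ℂ) * fderiv ℝ f z (Pi.single j 1)) -
      fun z => (z j : ℂ) * fderiv ℝ f z (Pi.single i 1)) z (Pi.single i 1)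
  erw [h2]
  simp [hij, hij.symm]
  ring

/-- As `i ≠ j`, the coefficient `z_i` is constant in the direction `e_j`, and integration by parts
leaves no extra term. Compact support is required of one factor only, so that the other may be a
polynomial. -/
theorem integral_coord_mul_fderiv {f g : (ι → ℝ) → ℂ} (hf : ContDiff ℝ ∞ f)
    (hc : HasCompactSupport f) (hg : ContDiff ℝ ∞ g) {i j : ι} (hij : i ≠ j) :
    ∫ z, z i * fderiv ℝ f z (Pi.single j 1) * g z =
      -∫ z, f z * (z i * fderiv ℝ g z (Pi.single j 1)) := by
  have hfd : Continuous fun z => fderiv ℝ f z (Pi.single j 1) :=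
    (contDiff_fderiv_apply hf _).continuous
  have hgd : Continuous fun z => fderiv ℝ g z (Pi.single j 1) :=
    (contDiff_fderiv_apply hg _).continuous
  have hz : Continuous fun z : ι → ℝ => (z i : ℂ) := (contDiff_coord i).continuous
  have hcd : HasCompactSupport fun z => fderiv ℝ f z (Pi.single j 1) :=
    hc.fderiv_apply ℝ _
  have h1 : ∀ z, fderiv ℝ (fun z => (z i : ℂ) * g z) z (Pi.single j 1) =
      z i * fderiv ℝ g z (Pi.single j 1) := by
    intro z
    have hk : HasFDerivAt (fun z : ι → ℝ => (z i : ℂ))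
        (Complex.ofRealCLM.comp (ContinuousLinearMap.proj i)) z :=
      (Complex.ofRealCLM.comp
        (ContinuousLinearMap.proj (R := ℝ) (φ := fun _ : ι => ℝ) i)).hasFDerivAt
    have h := (hk.mul (hg.contDiffAt.differentiableAt (x := z) (by simp)).hasFDerivAt).fderiv
    erw [h]
    simp [hij]
  have h2 := integral_mul_fderiv_eq_neg_fderiv_mul_of_integrable (μ := (volume : Measure (ι → ℝ)))
    (f := fun z => (z i : ℂ) * g z) (g := f) (v := Pi.single j 1) ?_ ?_ ?_ ?_ ?_
  · calc _ = ∫ z, z i * g z * fderiv ℝ f z (Pi.single j 1) :=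
          integral_congr_ae (.of_forall fun z => by ring)
      _ = _ := by
          rw [h2]
          congr 1
          refine integral_congr_ae (.of_forall fun z => ?_)
          simp only [h1]
          ring
  · simp only [h1]
    exact ((integrable_mul_of_compact hf.continuous hc (hz.mul hgd))).congr
      (.of_forall fun z => by simp only [Pi.mul_apply]; ring)
  · exact ((integrable_mul_of_compact hfd hcd (hz.mul hg.continuous))).congr
      (.of_forall fun z => by simp only [Pi.mul_apply]; ring)
  · exact ((integrable_mul_of_compact hf.continuous hc (hz.mul hg.continuous))).congr
      (.of_forall fun z => by simp only [Pi.mul_apply]; ring)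
  · exact fun z _ => (((contDiff_coord i).mul hg).contDiffAt).differentiableAt (by simp)
  · exact fun z _ => hf.contDiffAt.differentiableAt (by simp)

theorem integral_rotField_mul {f g : (ι → ℝ) → ℂ} (hf : ContDiff ℝ ∞ f)
    (hc : HasCompactSupport f) (hg : ContDiff ℝ ∞ g) {i j : ι} (hij : i ≠ j) :
    ∫ z, rotField f i j z * g z = -∫ z, f z * rotField g i j z := by
  have hz : ∀ k, Continuous fun z : ι → ℝ => (z k : ℂ) := fun k => (contDiff_coord k).continuous
  have h1 : ∀ k l, Integrable fun z => z k * fderiv ℝ f z (Pi.single l 1) * g z := fun k l =>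
    (integrable_mul_of_compact (contDiff_fderiv_apply hf (Pi.single l 1)).continuous
      (hc.fderiv_apply ℝ _) ((hz k).mul hg.continuous)).congr
      (.of_forall fun z => by simp only [Pi.mul_apply]; ring)
  have h2 : ∀ k l, Integrable fun z => f z * (z k * fderiv ℝ g z (Pi.single l 1)) := fun k l =>
    integrable_mul_of_compact hf.continuous hc
      ((hz k).mul (contDiff_fderiv_apply hg (Pi.single l 1)).continuous)
  simp only [rotField, sub_mul, mul_sub]
  rw [integral_sub (h1 i j) (h1 j i), integral_sub (h2 i j) (h2 j i),
    integral_coord_mul_fderiv hf hc hg hij, integral_coord_mul_fderiv hf hc hg hij.symm]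
  ring

theorem integral_rot2_mul {f g : (ι → ℝ) → ℂ} (hf : ContDiff ℝ ∞ f)
    (hc : HasCompactSupport f) (hg : ContDiff ℝ ∞ g) {i j : ι} (hij : i ≠ j) :
    ∫ z, rot2 f i j z * g z = ∫ z, f z * rot2 g i j z := by
  simp only [rot2_eq_rotField hf hij, rot2_eq_rotField hg hij]
  rw [integral_rotField_mul (contDiff_rotField hf i j) (hasCompactSupport_rotField hc i j) hg hij,
    integral_rotField_mul hf hc (contDiff_rotField hg i j) hij, neg_neg]

theorem continuous_rot2 {f : (ι → ℝ) → ℂ} (hf : ContDiff ℝ ∞ f) {i j : ι} (hij : i ≠ j) :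
    Continuous (rot2 f i j) := by
  rw [show rot2 f i j = rotField (rotField f i j) i j from
    funext fun z => rot2_eq_rotField hf hij z]
  exact (contDiff_rotField (contDiff_rotField hf i j) i j).continuous

theorem hasCompactSupport_rot2 {f : (ι → ℝ) → ℂ} (hf : ContDiff ℝ ∞ f)
    (hc : HasCompactSupport f) {i j : ι} (hij : i ≠ j) : HasCompactSupport (rot2 f i j) := by
  rw [show rot2 f i j = rotField (rotField f i j) i j from
    funext fun z => rot2_eq_rotField hf hij z]
  exact hasCompactSupport_rotField (hasCompactSupport_rotField hc i j) i j

variable {κ : Type*} [Fintype κ] [DecidableEq κ] {e : κ → ι}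

theorem integrable_angular_mul {f g : (ι → ℝ) → ℂ} (he : Function.Injective e)
    (hf : ContDiff ℝ ∞ f) (hc : HasCompactSupport f) (hg : Continuous g) :
    Integrable fun z => angular e f z * g z := by
  simp only [angular, mul_assoc, Finset.sum_mul]
  refine Integrable.const_mul (integrable_finsetSum _ fun i _ =>
    integrable_finsetSum _ fun j _ => ?_) _
  split_ifs with h
  · simp
  · exact integrable_mul_of_compact (continuous_rot2 hf (he.ne h))
      (hasCompactSupport_rot2 hf hc (he.ne h)) hg

/-- The angular operators are symmetric. -/
theorem integral_angular_mul {f g : (ι → ℝ) → ℂ} (he : Function.Injective e)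
    (hf : ContDiff ℝ ∞ f) (hc : HasCompactSupport f) (hg : ContDiff ℝ ∞ g) :
    ∫ z, angular e f z * g z = ∫ z, f z * angular e g z := by
  have h1 : ∀ i j, Integrable fun z =>
      (if i = j then 0 else rot2 f (e i) (e j) z) * g z := by
    intro i j
    split_ifs with h
    · simp
    · exact integrable_mul_of_compact (continuous_rot2 hf (he.ne h))
        (hasCompactSupport_rot2 hf hc (he.ne h)) hg.continuous
  have h2 : ∀ i j, Integrable fun z =>
      f z * (if i = j then 0 else rot2 g (e i) (e j) z) := by
    intro i j
    split_ifs with h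
    · simp
    · exact integrable_mul_of_compact hf.continuous hc (continuous_rot2 hg (he.ne h))
  simp only [angular, mul_left_comm (f _), mul_assoc, Finset.sum_mul]
  rw [integral_const_mul, integral_const_mul]
  congr 1
  simp only [Finset.mul_sum]
  rw [integral_finsetSum _ fun i _ => integrable_finsetSum _ fun j _ => h1 i j,
    integral_finsetSum _ fun i _ => integrable_finsetSum _ fun j _ => h2 i j]
  refine Finset.sum_congr rfl fun i _ => ?_
  rw [integral_finsetSum _ fun j _ => h1 i j, integral_finsetSum _ fun j _ => h2 i j]
  refine Finset.sum_congr rfl fun j _ => ?_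
  split_ifs with h
  · simp
  · exact integral_rot2_mul hf hc hg (he.ne h)

end Symmetry

/-! ### The angular operators on powers of linear forms -/

section Powers

theorem fderiv_pow_clm {E : Type*} [NormedAddCommGroup E] [NormedSpace ℝ E] (l : E →L[ℝ] ℂ)
    (a : ℕ) : fderiv ℝ (fun z => l z ^ a) = fun z => (a * l z ^ (a - 1)) • l := by
  funext z
  rw [(l.hasFDerivAt.pow a).fderiv]
  simp

theorem rot2_mul_of_invariant {ι : Type*} [DecidableEq ι] {f g : (ι → ℝ) → ℂ} {i j : ι} {z : ι → ℝ}
    (h : ∀ t, g (rot i j t z) = g z) : rot2 (fun z => g z * f z) i j z = g z * rot2 f i j z := by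
  simp only [rot2, h, iteratedDeriv_succ, iteratedDeriv_zero, deriv_const_mul_field']

variable {ι : Type*} [DecidableEq ι] {κ : Type*} [Fintype κ] [DecidableEq κ] {e : κ → ι}

/-- In the polar form, the radial terms contribute `-a(a-1) l^a - (card κ - 1) a l^a`, using that
`l` sees only the block. The Euclidean Laplacian contributes the second summand, which is of degree
`a - 2` in `l`. -/
theorem angular_pow [Fintype ι] (l : (ι → ℝ) →L[ℝ] ℂ) (a : ℕ) {z : ι → ℝ}
    (h : l (block e z) = l z) :
    angular e (fun z => l z ^ a) z =
      -((a : ℂ) * (a + Fintype.card κ - 2)) * l z ^ a +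
        a * ((a : ℂ) - 1) * (∑ i, l (Pi.single (e i) 1) ^ 2) *
          (((∑ i, z (e i) ^ 2 : ℝ) : ℂ) * l z ^ (a - 2)) := by
  have h1 : fderiv ℝ (fderiv ℝ fun z => l z ^ a) z =
      ((a * (((a - 1 : ℕ) : ℂ) * l z ^ (a - 1 - 1))) • l).smulRight l := by
    rw [fderiv_pow_clm]
    have h2 := ((l.hasFDerivAt (x := z)).pow (a - 1)).const_mul (a : ℂ)
    have h3 := h2.smul_const l
    refine h3.fderiv.trans ?_
    ext v w
    simp [mul_assoc]
  have h0 : fderiv ℝ (fun z => l z ^ a) z = (a * l z ^ (a - 1)) • l := by rw [fderiv_pow_clm]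
  rw [angular_eq (l.contDiff.pow a).contDiffAt, h1, h0]
  simp only [ContinuousLinearMap.smulRight_apply, smul_apply, smul_eq_mul, h]
  -- For `a = 0, 1` the exponents `a - 1` and `a - 2` may be truncated; there the factor `a (a - 1)`
  -- vanishes.
  rcases a with _ | _ | a
  · simp
  · simp
    ring
  · simp only [Nat.add_sub_cancel, ← Finset.mul_sum, mul_assoc, ← pow_two]
    push_cast
    ring

theorem angular_mul_of_invariant {f g : (ι → ℝ) → ℂ} {z : ι → ℝ}
    (h : ∀ i j, i ≠ j → ∀ t, g (rot (e i) (e j) t z) = g z) :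
    angular e (fun z => g z * f z) z = g z * angular e f z := by
  unfold angular
  rw [mul_left_comm, Finset.mul_sum (a := g z)]
  congr 1
  refine Finset.sum_congr rfl fun i _ => ?_
  rw [Finset.mul_sum]
  refine Finset.sum_congr rfl fun j _ => ?_
  split_ifs with hij
  · simp
  · exact rot2_mul_of_invariant (h i j hij)

end Powers

end AngularSymmetry

/-! ### Vanishing moments and Fourier uniqueness -/

section Moments

open MeasureTheory

/-! ### Functions with vanishing moments -/

section Fourier

variable {ι : Type*} [Fintype ι]

/-- A compactly supported function all of whose moments along a linear form vanish is orthogonal to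
the exponential of that form. -/
theorem integral_mul_exp_eq_zero {W : (ι → ℝ) → ℂ} (hW : Continuous W)
    (hc : HasCompactSupport W) (l : (ι → ℝ) →L[ℝ] ℂ) (h : ∀ n : ℕ, ∫ z, W z * l z ^ n = 0) :
    ∫ z, W z * Complex.exp (l z) = 0 := by
  -- On the support of `W` the form is bounded by `R`, so the exponential series is dominated by
  -- that of `e^R` and may be integrated term by term.
  obtain ⟨R, hR⟩ : ∃ R : ℝ, ∀ z ∈ tsupport W, ‖l z‖ ≤ R :=
    hc.isCompact.exists_bound_of_continuousOn l.continuous.continuousOn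
  have hint : ∀ n : ℕ, Integrable fun z => W z * (l z ^ n / n.factorial) := fun n =>
    integrable_mul_of_compact hW hc (by fun_prop)
  have hWn : Integrable fun z => ‖W z‖ := (hW.integrable_of_hasCompactSupport hc).norm
  have hbound : ∀ (n : ℕ) (z : ι → ℝ),
      ‖W z * (l z ^ n / n.factorial)‖ ≤ ‖W z‖ * (R ^ n / n.factorial) := by
    intro n z
    by_cases hz : z ∈ tsupport W
    · rw [norm_mul, norm_div, norm_pow, Complex.norm_natCast]
      gcongr
      exact hR z hz
    · simp [image_eq_zero_of_notMem_tsupport hz]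
  have hsum : Summable fun n : ℕ => ∫ z, ‖W z * (l z ^ n / n.factorial)‖ := by
    refine Summable.of_nonneg_of_le (fun n => integral_nonneg fun _ => norm_nonneg _)
      (fun n => ?_) ((Real.summable_pow_div_factorial R).mul_left (∫ z, ‖W z‖))
    rw [← integral_mul_const]
    exact integral_mono (hint n).norm (hWn.mul_const _) (hbound n)
  have hs := hasSum_integral_of_summable_integral_norm hint hsum
  have h0 : ∀ n : ℕ, ∫ z, W z * (l z ^ n / n.factorial) = 0 := by
    intro n
    simp only [← mul_div_assoc]
    rw [integral_div, h n, zero_div]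
  simp only [h0] at hs
  have h1 := hs.unique hasSum_zero
  rw [← h1]
  refine integral_congr_ae (.of_forall fun z => ?_)
  simp only
  rw [tsum_mul_left, Complex.exp_eq_exp_ℂ, NormedSpace.exp_eq_tsum_div]

/-- Uniqueness for the Fourier transform. -/
theorem eq_zero_of_fourier_eq_zero {W : (ι → ℝ) → ℂ} (hW : Continuous W)
    (hc : HasCompactSupport W)
    (h : ∀ ζ : ι → ℝ, ∫ z, W z * Complex.exp (-(2 * Real.pi * Complex.I) * ∑ i, ζ i * z i) = 0) :
    W = 0 := by
  -- The Fourier transform is taken on the Euclidean space; the identification with `ι → ℝ`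
  -- preserves volume.
  set W' : EuclideanSpace ℝ ι → ℂ := fun v => W (WithLp.ofLp v)
  have hvp := PiLp.volume_preserving_ofLp ι
  have hemb : MeasurableEmbedding (WithLp.ofLp : EuclideanSpace ℝ ι → ι → ℝ) :=
    (MeasurableEquiv.toLp 2 (ι → ℝ)).symm.measurableEmbedding
  have hW' : Continuous W' := hW.comp (PiLp.continuous_ofLp 2 _)
  have hi : Integrable W' :=
    (hvp.integrable_comp_emb hemb).2 (hW.integrable_of_hasCompactSupport hc)
  have hF : FourierTransform.fourier W' = 0 := by
    funext w
    rw [Real.fourier_eq']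
    have := hvp.integral_comp hemb fun z => W z *
      Complex.exp (-(2 * Real.pi * Complex.I) * ∑ i, WithLp.ofLp w i * z i)
    rw [h] at this
    rw [Pi.zero_apply, ← this]
    refine integral_congr_ae (.of_forall fun v => ?_)
    simp only [smul_eq_mul, W']
    rw [mul_comm]
    congr 2
    rw [PiLp.inner_apply]
    push_cast
    simp only [RCLike.inner_apply, conj_trivial]
    push_cast
    ring
  have hinv := hW'.fourierInv_fourier_eq hi (by rw [hF]; exact integrable_zero _ _ _)
  rw [hF] at hinv
  have h0 : W' = 0 := by
    rw [← hinv]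
    funext v
    simp [Real.fourierInv_eq']
  funext z
  exact congrFun h0 (WithLp.toLp 2 z)

end Fourier

/-! ### Moments of solutions of the reduced ultrahyperbolic equation -/

variable {p q : ℕ}

/-- Products of powers of `|x|²`, `|y|²` and of two linear forms. -/
def testFn (l₁ l₂ : Space p q →L[ℝ] ℂ) (k m a b : ℕ) (z : Space p q) : ℂ :=
  ((∑ i, z (Sum.inl i) ^ 2 : ℝ) : ℂ) ^ k * ((∑ i, z (Sum.inr i) ^ 2 : ℝ) : ℂ) ^ m *
    l₁ z ^ a * l₂ z ^ b

theorem contDiff_testFn (l₁ l₂ : Space p q →L[ℝ] ℂ) (k m a b : ℕ) :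
    ContDiff ℝ ∞ (testFn l₁ l₂ k m a b) := by
  have h1 : ContDiff ℝ ∞ fun z : Space p q => ((∑ i, z (Sum.inl i) ^ 2 : ℝ) : ℂ) := by
    have h : ContDiff ℝ ∞ fun z : Space p q => ∑ i, z (Sum.inl i) ^ 2 := by fun_prop
    exact Complex.ofRealCLM.contDiff.comp h
  have h2 : ContDiff ℝ ∞ fun z : Space p q => ((∑ i, z (Sum.inr i) ^ 2 : ℝ) : ℂ) := by
    have h : ContDiff ℝ ∞ fun z : Space p q => ∑ i, z (Sum.inr i) ^ 2 := by fun_prop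
    exact Complex.ofRealCLM.contDiff.comp h
  exact (((h1.pow k).mul (h2.pow m)).mul (l₁.contDiff.pow a)).mul (l₂.contDiff.pow b)

theorem block_inr_rot_inl (i j : Fin p) (t : ℝ) (z : Space p q) :
    block Sum.inr (rot (Sum.inl i) (Sum.inl j) t z) = block Sum.inr z := by
  simp only [block, rot_apply_of_not_mem (e := (Sum.inl : Fin p → Fin p ⊕ Fin q))
    (fun _ => Sum.inr_ne_inl)]

theorem block_inl_rot_inr (i j : Fin q) (t : ℝ) (z : Space p q) :
    block Sum.inl (rot (Sum.inr i) (Sum.inr j) t z) = block Sum.inl z := by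
  simp only [block, rot_apply_of_not_mem (e := (Sum.inr : Fin q → Fin p ⊕ Fin q))
    (fun _ => Sum.inl_ne_inr)]

variable {l₁ l₂ : Space p q →L[ℝ] ℂ}

/-- Rotations of `x` fix `|x|²`, `|y|²` and `l₂`, so only `l₁ ^ a` is differentiated. The remainder
trades two powers of `l₁` for one factor `|x|²`; the radial factors are there to keep the family
closed under this. -/
theorem angular_inl_testFn (h1 : ∀ z, l₁ (block Sum.inl z) = l₁ z)
    (h2 : ∀ z, l₂ (block Sum.inr z) = l₂ z) (k m a b : ℕ) (z : Space p q) :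
    angular Sum.inl (testFn l₁ l₂ k m a b) z =
      -((a : ℂ) * (a + p - 2)) * testFn l₁ l₂ k m a b z +
        a * ((a : ℂ) - 1) * (∑ i : Fin p, l₁ (Pi.single (Sum.inl i) 1) ^ 2) *
          testFn l₁ l₂ (k + 1) m (a - 2) b z := by
  have h3 : testFn l₁ l₂ k m a b = fun z =>
      (((∑ i, z (Sum.inl i) ^ 2 : ℝ) : ℂ) ^ k * ((∑ i, z (Sum.inr i) ^ 2 : ℝ) : ℂ) ^ m *
        l₂ z ^ b) * l₁ z ^ a := by
    funext z
    simp only [testFn]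
    ring
  rw [h3, angular_mul_of_invariant (e := Sum.inl), angular_pow l₁ a (h1 z), testFn]
  · simp only [Fintype.card_fin]
    ring
  · intro i j hij t
    rw [sum_rot_sq Sum.inl_injective hij, ← h2, block_inr_rot_inl, h2]
    simp only [rot_apply_of_not_mem (e := (Sum.inl : Fin p → Fin p ⊕ Fin q))
      (fun _ => Sum.inr_ne_inl)]

theorem angular_inr_testFn (h1 : ∀ z, l₁ (block Sum.inl z) = l₁ z)
    (h2 : ∀ z, l₂ (block Sum.inr z) = l₂ z) (k m a b : ℕ) (z : Space p q) :
    angular Sum.inr (testFn l₁ l₂ k m a b) z =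
      -((b : ℂ) * (b + q - 2)) * testFn l₁ l₂ k m a b z +
        b * ((b : ℂ) - 1) * (∑ i : Fin q, l₂ (Pi.single (Sum.inr i) 1) ^ 2) *
          testFn l₁ l₂ k (m + 1) a (b - 2) z := by
  have h3 : testFn l₁ l₂ k m a b = fun z =>
      (((∑ i, z (Sum.inl i) ^ 2 : ℝ) : ℂ) ^ k * ((∑ i, z (Sum.inr i) ^ 2 : ℝ) : ℂ) ^ m *
        l₁ z ^ a) * l₂ z ^ b := rfl
  rw [h3, angular_mul_of_invariant (e := Sum.inr), angular_pow l₂ b (h2 z), testFn]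
  · simp only [Fintype.card_fin]
    ring
  · intro i j hij t
    rw [sum_rot_sq Sum.inr_injective hij, ← h1, block_inl_rot_inr, h1]
    simp only [rot_apply_of_not_mem (e := (Sum.inr : Fin q → Fin p ⊕ Fin q))
      (fun _ => Sum.inl_ne_inr)]

theorem testFn_neg (k m a b : ℕ) (z : Space p q) :
    testFn l₁ l₂ k m a b (-z) = (-1) ^ (a + b) * testFn l₁ l₂ k m a b z := by
  simp only [testFn, map_neg, Pi.neg_apply, neg_sq]
  rw [neg_pow (l₁ z), neg_pow (l₂ z)]
  ring

/-- The eigenvalues of the angular operators on spherical harmonics of degrees `a`, `b` differ by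
the constant of the Yamabe operator only if `b - a = (p - q) / 2`. -/
theorem eigenvalue_ne (hp : 2 ≤ p) (hq : 2 ≤ q) {r : ℤ} (hr : (p : ℤ) - q = 2 * r) {a b : ℕ}
    (hab : ¬ Even ((a : ℤ) + b - r)) :
    -((a : ℂ) * (a + p - 2)) + (b : ℂ) * (b + q - 2) - yamabeConst p q ≠ 0 := by
  intro h
  -- Since `4 * yamabeConst p q = (p-2)² - (q-2)²`, completing squares turns the vanishing into an
  -- equality of two squares. Both bases are nonnegative because `p, q ≥ 2`, so they agree: `b - a =
  -- r` and `a + b - r = 2a`.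
  have h1 : ((2 * b + q - 2 : ℤ) : ℂ) ^ 2 = ((2 * a + p - 2 : ℤ) : ℂ) ^ 2 := by
    rw [yamabeConst] at h
    push_cast
    linear_combination 4 * h
  have h2 : (2 * b + q - 2 : ℤ) ^ 2 = (2 * a + p - 2 : ℤ) ^ 2 := by exact_mod_cast h1
  have h3 : (2 * b + q - 2 : ℤ) = 2 * a + p - 2 :=
    (pow_left_inj₀ (by omega) (by omega) two_ne_zero).1 h2
  exact hab ⟨a, by omega⟩

/-- The integral vanishes by parity when `a + b ≡ r` modulo 2. Otherwise, symmetry of the angular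
operators shows that a nonzero multiple of it is a combination of integrals in which `a` or `b` has
dropped by 2. -/
theorem integral_mul_testFn_eq_zero (hp : 2 ≤ p) (hq : 2 ≤ q) {r : ℤ}
    (hr : (p : ℤ) - q = 2 * r) {W : Space p q → ℂ} (hW : ContDiff ℝ ∞ W)
    (hc : HasCompactSupport W)
    (hPDE : ∀ z, angular Sum.inl W z - angular Sum.inr W z = yamabeConst p q * W z)
    (hanti : ∀ z, W (-z) = -(-1) ^ r * W z)
    (h1 : ∀ z, l₁ (block Sum.inl z) = l₁ z) (h2 : ∀ z, l₂ (block Sum.inr z) = l₂ z)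
    (k m a b : ℕ) : ∫ z, W z * testFn l₁ l₂ k m a b z = 0 := by
  by_cases hab : Even ((a : ℤ) + b - r)
  -- The test function has sign `(-1)^r` under `z ↦ -z` and `W` has the opposite sign, so the
  -- integrand is odd.
  · have hsign : (-1 : ℂ) ^ (a + b) = (-1) ^ r := by
      have h3 : (-1 : ℂ) ^ (((a + b : ℕ) : ℤ) - r) = 1 := by
        push_cast
        exact hab.neg_one_zpow
      rw [zpow_sub₀ (by norm_num), zpow_natCast] at h3
      exact (div_eq_one_iff_eq (zpow_ne_zero _ (by norm_num))).1 h3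
    have hsq : (-1 : ℂ) ^ r * (-1) ^ r = 1 := by
      rw [← mul_zpow]; simp
    have h3 := integral_neg_eq_self (fun z => W z * testFn l₁ l₂ k m a b z) volume
    simp only [hanti, testFn_neg, hsign] at h3
    have h4 : ∀ z, -(-1) ^ r * W z * ((-1) ^ r * testFn l₁ l₂ k m a b z) =
        -(W z * testFn l₁ l₂ k m a b z) := fun z => by
      linear_combination -(W z * testFn l₁ l₂ k m a b z) * hsq
    simp only [h4, integral_neg] at h3
    exact self_eq_neg.1 h3.symm
  -- Each reduction preserves the parity of `a + b`, hence the case assumption, but raises `k` or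
  -- `m`; these are therefore generalized.
  · induction hn : a + b using Nat.strong_induction_on generalizing k m a b with
    | _ n ih =>
    have hint : ∀ k m a b, Integrable fun z => W z * testFn l₁ l₂ k m a b z := fun k m a b =>
      integrable_mul_of_compact hW.continuous hc (contDiff_testFn l₁ l₂ k m a b).continuous
    have hv := contDiff_testFn l₁ l₂ k m a b
    have e1 := integral_angular_mul Sum.inl_injective hW hc hv
    have e2 := integral_angular_mul Sum.inr_injective hW hc hv
    have e3 : ∫ z, yamabeConst p q * (W z * testFn l₁ l₂ k m a b z) =
        (∫ z, angular Sum.inl W z * testFn l₁ l₂ k m a b z) -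
          ∫ z, angular Sum.inr W z * testFn l₁ l₂ k m a b z := by
      rw [← integral_sub (integrable_angular_mul Sum.inl_injective hW hc hv.continuous)
        (integrable_angular_mul Sum.inr_injective hW hc hv.continuous)]
      refine integral_congr_ae (.of_forall fun z => ?_)
      simp only
      rw [← sub_mul, hPDE, mul_assoc]
    have e4 : (a : ℂ) * ((a : ℂ) - 1) * (∑ i : Fin p, l₁ (Pi.single (Sum.inl i) 1) ^ 2) *
        ∫ z, W z * testFn l₁ l₂ (k + 1) m (a - 2) b z = 0 := by
      rcases a with _ | _ | a
      · simp
      · simp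
      · rw [ih (a + b) (by omega) (k + 1) m (a + 1 + 1 - 2) b ?_ (by omega), mul_zero]
        intro h
        apply hab
        rw [show ((a + 1 + 1 : ℕ) : ℤ) + b - r = (((a + 1 + 1 - 2 : ℕ) : ℤ) + b - r) + 2 by
          omega]
        exact h.add even_two
    have e5 : (b : ℂ) * ((b : ℂ) - 1) * (∑ i : Fin q, l₂ (Pi.single (Sum.inr i) 1) ^ 2) *
        ∫ z, W z * testFn l₁ l₂ k (m + 1) a (b - 2) z = 0 := by
      rcases b with _ | _ | b
      · simp
      · simp
      · rw [ih (a + b) (by omega) k (m + 1) a (b + 1 + 1 - 2) ?_ (by omega), mul_zero]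
        intro h
        apply hab
        rw [show (a : ℤ) + ((b + 1 + 1 : ℕ) : ℤ) - r = ((a : ℤ) + ((b + 1 + 1 - 2 : ℕ) : ℤ) - r) + 2
          by omega]
        exact h.add even_two
    simp only [angular_inl_testFn h1 h2, angular_inr_testFn h1 h2, mul_add, mul_left_comm (W _)]
      at e1 e2
    rw [integral_add ((hint _ _ _ _).const_mul _) ((hint _ _ _ _).const_mul _),
      integral_const_mul, integral_const_mul, e4] at e1
    rw [integral_add ((hint _ _ _ _).const_mul _) ((hint _ _ _ _).const_mul _),
      integral_const_mul, integral_const_mul, e5] at e2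
    rw [integral_const_mul, e1, e2] at e3
    -- The remainders are gone, so the integral is multiplied by the difference of the eigenvalues
    -- minus the Yamabe constant, which is nonzero for this parity.
    refine (mul_eq_zero.1 ?_).resolve_left (eigenvalue_ne hp hq hr hab)
    linear_combination -e3

/-- Splitting a frequency into its `x` and `y` components writes the phase as `l₁ + l₂`. By the
binomial theorem its powers are combinations of test functions, so all moments vanish, and with them
the Fourier transform. -/
theorem eq_zero_of_angular_eq (hp : 2 ≤ p) (hq : 2 ≤ q) {r : ℤ}
    (hr : (p : ℤ) - q = 2 * r) {W : Space p q → ℂ} (hW : ContDiff ℝ ∞ W)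
    (hc : HasCompactSupport W)
    (hPDE : ∀ z, angular Sum.inl W z - angular Sum.inr W z = yamabeConst p q * W z)
    (hanti : ∀ z, W (-z) = -(-1) ^ r * W z) : W = 0 := by
  refine eq_zero_of_fourier_eq_zero hW.continuous hc fun ζ => ?_
  set form : (Fin p ⊕ Fin q → ℝ) → Space p q →L[ℝ] ℂ := fun ζ =>
    ∑ k, (-(2 * Real.pi * Complex.I) * ζ k) •
      Complex.ofRealCLM.comp (ContinuousLinearMap.proj (R := ℝ) (φ := fun _ => ℝ) k)
  have hform : ∀ ζ z, form ζ z = -(2 * Real.pi * Complex.I) * ∑ k, ζ k * z k := by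
    intro ζ z
    push_cast
    rw [Finset.mul_sum]
    simp [form, mul_assoc]
    ring
  set l₁ := form (block Sum.inl ζ)
  set l₂ := form (block Sum.inr ζ)
  have h1 : ∀ z, l₁ (block Sum.inl z) = l₁ z := fun z => by
    simp [l₁, hform, block_inl, Fintype.sum_sum_type]
  have h2 : ∀ z, l₂ (block Sum.inr z) = l₂ z := fun z => by
    simp [l₂, hform, block_inr, Fintype.sum_sum_type]
  have h3 : ∀ z, -(2 * Real.pi * Complex.I) * ((∑ i, ζ i * z i : ℝ) : ℂ) = (l₁ + l₂) z := fun z => by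
    simp [l₁, l₂, hform, block_inl, block_inr, Fintype.sum_sum_type]
    ring
  simp only [h3]
  refine integral_mul_exp_eq_zero hW.continuous hc (l₁ + l₂) fun n => ?_
  have h4 : ∀ z, W z * (l₁ + l₂) z ^ n = ∑ j ∈ Finset.range (n + 1),
      W z * testFn l₁ l₂ 0 0 j (n - j) z * (n.choose j : ℂ) := by
    intro z
    simp [add_pow, Finset.mul_sum, testFn, mul_assoc]
  simp only [h4]
  rw [integral_finsetSum]
  · refine Finset.sum_eq_zero fun j _ => ?_
    rw [integral_mul_const, integral_mul_testFn_eq_zero hp hq hr hW hc hPDE hanti h1 h2, zero_mul]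
  · intro j _
    exact (integrable_mul_of_compact hW.continuous hc
      (contDiff_testFn l₁ l₂ 0 0 j (n - j)).continuous).mul_const _

end Moments

/-! ### Parity of the solutions of the Yamabe equation -/

section Parity

variable {p q : ℕ}

/-! ### The parity of the solutions of the Yamabe equation -/

theorem normX_neg (z : Space p q) : normX (-z) = normX z := by simp [normX]

theorem normY_neg (z : Space p q) : normY (-z) = normY z := by simp [normY]

/-- The antipodal map of `M`. -/
def negM (z : spheres p q) : spheres p q :=
  ⟨-(z : Space p q), (normX_neg _).trans z.2.1, (normY_neg _).trans z.2.2⟩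

theorem normX_sq (z : Space p q) : normX z ^ 2 = ∑ i, z (Sum.inl i) ^ 2 :=
  Real.sq_sqrt (Finset.sum_nonneg fun _ _ => sq_nonneg _)

theorem normY_sq (z : Space p q) : normY z ^ 2 = ∑ i, z (Sum.inr i) ^ 2 :=
  Real.sq_sqrt (Finset.sum_nonneg fun _ _ => sq_nonneg _)

/-- A smooth function on the real line which is supported near `1`. -/
def bumpOne : ContDiffBump (1 : ℝ) := ⟨1 / 4, 1 / 2, by norm_num, by norm_num⟩

theorem bumpOne_eq_zero {t : ℝ} (ht : t ≤ 1 / 2 ∨ 3 / 2 ≤ t) : bumpOne t = 0 := by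
  refine bumpOne.zero_of_le_dist ?_
  change (1 / 2 : ℝ) ≤ _
  rw [Real.dist_eq, le_abs]
  rcases ht with h | h
  · right; linarith
  · left; linarith

/-- A radial cut-off function around `M`. -/
def cutoff (z : Space p q) : ℂ := ((bumpOne (normX z ^ 2) * bumpOne (normY z ^ 2) : ℝ) : ℂ)

/-- The cut-off uses the squares of the norms, which are polynomial and hence smooth also where `x =
0` or `y = 0`. -/
theorem contDiff_cutoff : ContDiff ℝ ∞ (cutoff : Space p q → ℂ) := by
  have h1 : ContDiff ℝ ∞ fun z : Space p q => normX z ^ 2 := by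
    simp only [normX_sq]; fun_prop
  have h2 : ContDiff ℝ ∞ fun z : Space p q => normY z ^ 2 := by
    simp only [normY_sq]; fun_prop
  exact Complex.ofRealCLM.contDiff.comp
    ((bumpOne.contDiff.comp h1).mul (bumpOne.contDiff.comp h2))

theorem cutoff_of_mem (z : spheres p q) : cutoff (z : Space p q) = 1 := by
  have h : bumpOne 1 = 1 := bumpOne.one_of_mem_closedBall (by simp [bumpOne])
  rw [cutoff, show normX (z : Space p q) = 1 from z.2.1,
    show normY (z : Space p q) = 1 from z.2.2]
  simp [h]

theorem bounds_of_cutoff_ne_zero {z : Space p q} (h : cutoff z ≠ 0) :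
    (1 / 2 < normX z ^ 2 ∧ normX z ^ 2 < 3 / 2) ∧ 1 / 2 < normY z ^ 2 ∧ normY z ^ 2 < 3 / 2 := by
  have h1 : bumpOne (normX z ^ 2) * bumpOne (normY z ^ 2) ≠ 0 := by
    intro h0
    exact h (by rw [cutoff, h0, Complex.ofReal_zero])
  refine ⟨?_, ?_⟩
  · by_contra h2
    refine h1 (by rw [bumpOne_eq_zero (t := normX z ^ 2), zero_mul]; grind)
  · by_contra h2
    refine h1 (by rw [bumpOne_eq_zero (t := normY z ^ 2), mul_zero]; grind)

theorem pos_of_cutoff_ne_zero {z : Space p q} (h : cutoff z ≠ 0) :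
    0 < normX z ∧ 0 < normY z := by
  obtain ⟨⟨h1, _⟩, h2, _⟩ := bounds_of_cutoff_ne_zero h
  refine ⟨(normX_nonneg z).lt_of_ne fun h0 => ?_, (normY_nonneg z).lt_of_ne fun h0 => ?_⟩
  · rw [← h0] at h1; norm_num at h1
  · rw [← h0] at h2; norm_num at h2

theorem contDiff_cutoff_mul_extend {f : spheres p q → ℂ} (hf : f ∈ SmoothM p q) :
    ContDiff ℝ ∞ fun z => cutoff z * extend f z := by
  rw [contDiff_iff_contDiffAt]
  intro z
  by_cases hz : 0 < normX z ∧ 0 < normY z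
  · exact contDiff_cutoff.contDiffAt.mul (contDiffAt_extend_of_pos hf hz.1 hz.2)
  · refine (contDiffAt_const (c := (0 : ℂ))).congr_of_eventuallyEq ?_
    have hc : Continuous fun z : Space p q => (normX z ^ 2) := continuous_normX.pow 2
    have hc' : Continuous fun z : Space p q => (normY z ^ 2) := continuous_normY.pow 2
    have hev : ∀ᶠ w in nhds z, normX w ^ 2 < 1 / 2 ∨ normY w ^ 2 < 1 / 2 := by
      rcases not_and_or.1 hz with h | h
      · have h0 : normX z = 0 := le_antisymm (not_lt.1 h) (normX_nonneg z)
        filter_upwards [hc.continuousAt.eventually_lt_const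
          (show normX z ^ 2 < 1 / 2 by rw [h0]; norm_num)] with w hw using Or.inl hw
      · have h0 : normY z = 0 := le_antisymm (not_lt.1 h) (normY_nonneg z)
        filter_upwards [hc'.continuousAt.eventually_lt_const
          (show normY z ^ 2 < 1 / 2 by rw [h0]; norm_num)] with w hw using Or.inr hw
    filter_upwards [hev] with w hw
    have : cutoff w = 0 := by
      by_contra h
      obtain ⟨⟨h1, _⟩, h2, _⟩ := bounds_of_cutoff_ne_zero h
      rcases hw with hw | hw <;> linarith
    rw [this, zero_mul]

theorem hasCompactSupport_cutoff_mul (u : Space p q → ℂ) :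
    HasCompactSupport fun z => cutoff z * u z := by
  refine HasCompactSupport.intro (isCompact_closedBall (0 : Space p q) 2) fun z hz => ?_
  by_contra h
  obtain ⟨⟨_, h1⟩, _, h2⟩ := bounds_of_cutoff_ne_zero (left_ne_zero_of_mul h)
  apply hz
  rw [mem_closedBall_zero_iff, pi_norm_le_iff_of_nonneg (by norm_num)]
  rw [normX_sq] at h1
  rw [normY_sq] at h2
  intro k
  rw [Real.norm_eq_abs]
  refine abs_le_of_sq_le_sq ?_ (by norm_num)
  cases k with
  | inl i =>
    have := Finset.single_le_sum (f := fun i => z (Sum.inl i) ^ 2) (fun _ _ => sq_nonneg _)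
      (Finset.mem_univ i)
    linarith
  | inr j =>
    have := Finset.single_le_sum (f := fun i => z (Sum.inr i) ^ 2) (fun _ _ => sq_nonneg _)
      (Finset.mem_univ j)
    linarith

theorem rot_smul_of_scale {ι κ : Type*} [DecidableEq ι] {e : κ → ι} {v w : ι → ℝ} {s : ℝ}
    (h : ∀ k, v (e k) = s * w (e k)) (i j : κ) (t : ℝ) (k : κ) :
    rot (e i) (e j) t v (e k) = s * rot (e i) (e j) t w (e k) := by
  simp only [rot, Pi.add_apply, Pi.sub_apply, Pi.smul_apply, smul_eq_mul, h]
  ring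

theorem eq_normX_mul_radial {z : Space p q} (hx : 0 < normX z) (i : Fin p) :
    z (Sum.inl i) = normX z * radial z (Sum.inl i) := by
  simp [radial, mul_div_cancel₀ _ hx.ne']

theorem eq_normY_mul_radial {z : Space p q} (hy : 0 < normY z) (j : Fin q) :
    z (Sum.inr j) = normY z * radial z (Sum.inr j) := by
  simp [radial, mul_div_cancel₀ _ hy.ne']

/-- Rotations commute with independent rescalings of `x` and `y`, and the extension is invariant
under these. The Yamabe equation on `M` thereby holds for the extension wherever `x` and `y` are
both nonzero. -/
theorem angular_inl_extend (f : spheres p q → ℂ) {z : Space p q} (hx : 0 < normX z)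
    (hy : 0 < normY z) : angular Sum.inl (extend f) z = angular Sum.inl (extend f) (radial z) := by
  refine angular_congr fun i j _ => .of_forall fun t => extend_congr f
    (radial_eq_of_scale hx hy (rot_smul_of_scale (eq_normX_mul_radial hx) i j t) fun k => ?_)
  simp only [rot_apply_of_not_mem (e := (Sum.inl : Fin p → Fin p ⊕ Fin q))
    (fun _ => Sum.inr_ne_inl), ← eq_normY_mul_radial hy]

theorem angular_inr_extend (f : spheres p q → ℂ) {z : Space p q} (hx : 0 < normX z)
    (hy : 0 < normY z) : angular Sum.inr (extend f) z = angular Sum.inr (extend f) (radial z) := by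
  refine angular_congr fun i j _ => .of_forall fun t => extend_congr f
    (radial_eq_of_scale hx hy (fun k => ?_) (rot_smul_of_scale (eq_normY_mul_radial hy) i j t))
  simp only [rot_apply_of_not_mem (e := (Sum.inr : Fin q → Fin p ⊕ Fin q))
    (fun _ => Sum.inl_ne_inr), ← eq_normX_mul_radial hx]

/-- The cut-off is invariant under rotations of either factor and under `z ↦ -z`, so multiplying by
it preserves both the angular equation and the sign rule. It equals 1 on `M`, so the vanishing of
the product gives that of `g`. -/
theorem eq_zero_of_mem_V_of_antisymmetric (hp : 2 ≤ p) (hq : 2 ≤ q) {r : ℤ}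
    (hr : (p : ℤ) - q = 2 * r) {g : SmoothM p q} (hg : g ∈ V p q)
    (hanti : ∀ z, (g : spheres p q → ℂ) (negM z) = -(-1) ^ r * (g : spheres p q → ℂ) z) :
    g = 0 := by
  have hW := eq_zero_of_angular_eq hp hq hr (contDiff_cutoff_mul_extend g.2)
    (hasCompactSupport_cutoff_mul _) (fun z => ?_) (fun z => ?_)
  · refine Subtype.ext (funext fun z => ?_)
    have h := congrFun hW z
    simpa [cutoff_of_mem, extend_of_mem] using h
  · rw [angular_mul_of_invariant (e := Sum.inl) fun i j hij t => by
        rw [cutoff, normX_rot_inl hij, normY_rot_inl, cutoff],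
      angular_mul_of_invariant (e := Sum.inr) fun i j hij t => by
        rw [cutoff, normX_rot_inr, normY_rot_inr hij, cutoff]]
    by_cases hz : cutoff z = 0
    · simp [hz]
    · obtain ⟨hx, hy⟩ := pos_of_cutoff_ne_zero hz
      have h1 := hg ⟨radial z, radial_mem hx hy⟩
      rw [yamabe_apply hp hq, lapX_eq_angular g.2, lapY_eq_angular g.2,
        ← extend_of_mem (g : spheres p q → ℂ)] at h1
      simp only [← angular_inl_extend _ hx hy, ← angular_inr_extend _ hx hy] at h1
      rw [extend_congr _ (radial_of_mem (radial_mem hx hy))] at h1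
      linear_combination cutoff z * h1
  · have hc : cutoff (-z) = cutoff z := by rw [cutoff, normX_neg, normY_neg, cutoff]
    rw [hc]
    by_cases hz : cutoff z = 0
    · simp [hz]
    · obtain ⟨hx, hy⟩ := pos_of_cutoff_ne_zero hz
      have h1 := hanti ⟨radial z, radial_mem hx hy⟩
      rw [← extend_of_mem (g : spheres p q → ℂ), ← extend_of_mem (g : spheres p q → ℂ)] at h1
      have h2 : radial (-z) = -radial z := by
        funext k
        cases k <;> simp [radial, normX_neg, normY_neg, neg_div]
      have h3 : extend (g : spheres p q → ℂ) (-z) =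
          extend g (negM ⟨radial z, radial_mem hx hy⟩ : Space p q) :=
        extend_congr _ ((radial_of_mem (negM ⟨radial z, radial_mem hx hy⟩).2).trans h2.symm).symm
      have h4 : extend (g : spheres p q → ℂ) (radial z) = extend g z :=
        extend_congr _ (radial_of_mem (radial_mem hx hy))
      rw [h3, h1, h4]
      ring

theorem m0_inv : (m0 p q)⁻¹ = m0 p q := inv_eq_of_mul_eq_one_left m0_mul_self

theorem mat_m0_mulVec (v : Space p q) : mat (m0 p q) *ᵥ v = -v := by
  change (-1 : Mat p q) *ᵥ v = -v
  rw [Matrix.neg_mulVec, Matrix.one_mulVec]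

theorem varpi_m0_apply (lam : ℂ) (f : SmoothM p q) (z : spheres p q) :
    (varpi p q lam (m0 p q) f : spheres p q → ℂ) z = (f : spheres p q → ℂ) (negM z) := by
  rw [varpi_apply, m0_inv, mat_m0_mulVec, homExt, normX_neg,
    show normX (z : Space p q) = 1 from z.2.1, Complex.ofReal_one, Complex.one_cpow, one_mul]
  exact extend_of_mem _ (negM z)

/-- The solutions of the Yamabe equation are even or odd, depending on `(p - q) / 2`. -/
theorem apply_negM (hp : 2 ≤ p) (hq : 2 ≤ q) {r : ℤ} (hr : (p : ℤ) - q = 2 * r)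
    {f : SmoothM p q} (hf : f ∈ V p q) (z : spheres p q) :
    (f : spheres p q → ℂ) (negM z) = (-1) ^ r * (f : spheres p q → ℂ) z := by
  -- The component of `f` of the wrong parity, up to sign and a factor 2. It lies in `V` because the
  -- antipodal map is the action of `m₀`, under which `V` is already known to be stable.
  set g : SmoothM p q := varpi p q (((p : ℂ) + q - 4) / 2) (m0 p q) f - (-1 : ℂ) ^ r • f with hgdef
  have hg : g ∈ V p q :=
    Submodule.sub_mem _ (varpi_mem_V hp hq _ hf) (Submodule.smul_mem _ _ hf)
  have hga : ∀ z, (g : spheres p q → ℂ) z =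
      (f : spheres p q → ℂ) (negM z) - (-1) ^ r * (f : spheres p q → ℂ) z := by
    intro z
    rw [← varpi_m0_apply (((p : ℂ) + q - 4) / 2)]
    rfl
  have hsq : (-1 : ℂ) ^ r * (-1) ^ r = 1 := by
    rw [← mul_zpow]; simp
  have h0 := eq_zero_of_mem_V_of_antisymmetric hp hq hr hg fun z => by
    have hnn : negM (negM z) = z := Subtype.ext (neg_neg _)
    rw [hga, hga, hnn]
    linear_combination -(f : spheres p q → ℂ) z * hsq
  have h1 := hga z
  rw [h0] at h1
  exact (sub_eq_zero.1 h1.symm)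

end Parity

/-! ### Extension to the cone, transitivity of `O(p,q)`, and matrix exponentials -/

section Reflections

variable {p q : ℕ}

/-! ### Homogeneous extension to the light cone -/

theorem coe_neg_one_zpow (r : ℤ) : ((((-1 : ℤˣ) ^ r : ℤˣ) : ℤ) : ℂ) = (-1) ^ r := by
  rcases Int.even_or_odd r with h | h
  · rw [h.neg_one_zpow, h.neg_one_zpow]; simp
  · rw [h.neg_one_zpow, h.neg_one_zpow]; simp

theorem normY_pos (ξ : cone p q) : 0 < normY (ξ : Space p q) := by
  rw [← show normX (ξ : Space p q) = normY (ξ : Space p q) from ξ.2.1]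
  exact normX_pos ξ

theorem proj_negCone (ξ : cone p q) : proj (negCone ξ) = negM (proj ξ) := by
  apply Subtype.ext
  change radial (-(ξ : Space p q)) = -radial (ξ : Space p q)
  funext k
  cases k <;> simp [radial, normX_neg, normY_neg, neg_div]

theorem homExt_mem_S (a : ℂ) (ε : ℤˣ) {f : spheres p q → ℂ} (hf : f ∈ SmoothM p q)
    (h : ∀ z, f (negM z) = ((ε : ℤ) : ℂ) * f z) :
    (fun ξ : cone p q => homExt a f ξ) ∈ S p q a ε := by
  refine ⟨fun ξ => ⟨{v | 0 < normX v} ∩ {v | 0 < normY v},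
    (isOpen_lt continuous_const continuous_normX).inter
      (isOpen_lt continuous_const continuous_normY), ⟨normX_pos ξ, normY_pos ξ⟩, homExt a f,
    fun v hv => (contDiffAt_homExt a hf hv.1 hv.2).contDiffWithinAt, fun _ _ => rfl⟩,
    fun t ht ξ => homExt_smul a f ht ξ, fun ξ => ?_⟩
  change homExt a f (negCone ξ) = _ * homExt a f ξ
  rw [homExt_cone, homExt_cone, proj_negCone, h]
  change ((normX (-(ξ : Space p q)) : ℝ) : ℂ) ^ a * _ = _
  rw [normX_neg]
  ring

/-- Both sides are homogeneous of degree `-lam` on the cone, and `varpi_apply` compares them on `M`.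
-/
theorem homExt_varpi (lam : ℂ) (h : G p q) (f : SmoothM p q) (ξ : cone p q) :
    homExt (-lam) (varpi p q lam h f : spheres p q → ℂ) ξ =
      homExt (-lam) (f : spheres p q → ℂ) (h⁻¹ • ξ : cone p q) := by
  have h1 : ((toCone (proj ξ) : cone p q) : Space p q) =
      (nu (ξ : Space p q))⁻¹ • (ξ : Space p q) := radial_eq ξ
  have h2 : mat h⁻¹ *ᵥ (ξ : Space p q) =
      nu (ξ : Space p q) • (mat h⁻¹ *ᵥ ((toCone (proj ξ) : cone p q) : Space p q)) := by
    rw [h1, Matrix.mulVec_smul, smul_smul, mul_inv_cancel₀ (normX_pos ξ).ne', one_smul]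
  rw [homExt_cone, varpi_apply, coe_smul, h2, homExt_smul _ _ (normX_pos ξ)]
  rfl

/-! ### The invariant form and reflections -/

variable (p q) in
/-- The quadratic form of signature `(p, q)`. -/
def bil : LinearMap.BilinForm ℝ (Space p q) := Matrix.toBilin' (Ipq p q)

theorem bil_apply (v w : Space p q) : bil p q v w = v ⬝ᵥ (Ipq p q *ᵥ w) :=
  Matrix.toBilin'_apply' _ _ _

theorem Ipq_mulVec (v : Space p q) :
    Ipq p q *ᵥ v = Sum.elim (fun i => v (Sum.inl i)) (fun j => -v (Sum.inr j)) := by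
  funext k
  cases k <;> simp [LieAlgebra.Orthogonal.indefiniteDiagonal, Matrix.mulVec_diagonal]

theorem bil_eq_sum (v w : Space p q) : bil p q v w =
    ∑ i, v (Sum.inl i) * w (Sum.inl i) - ∑ j, v (Sum.inr j) * w (Sum.inr j) := by
  rw [bil_apply, Ipq_mulVec]
  simp [dotProduct, Fintype.sum_sum_type, sub_eq_add_neg]

theorem bil_comm (v w : Space p q) : bil p q v w = bil p q w v := by
  simp only [bil_eq_sum, mul_comm]

theorem bil_mulVec (g : G p q) (v w : Space p q) :
    bil p q (mat g *ᵥ v) (mat g *ᵥ w) = bil p q v w := by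
  have h : (mat g)ᵀ * Ipq p q * mat g = Ipq p q := g.2
  rw [bil_apply, bil_apply]
  conv_rhs => rw [← h]
  rw [← Matrix.mulVec_mulVec, ← Matrix.mulVec_mulVec, Matrix.dotProduct_mulVec v,
    Matrix.vecMul_transpose]

theorem bil_self_of_mem (ξ : cone p q) : bil p q ξ ξ = 0 := by
  rw [bil_apply, form_eq, show normX (ξ : Space p q) = normY (ξ : Space p q) from ξ.2.1, sub_self]

theorem mem_cone_of_bil {v : Space p q} (h : bil p q v v = 0) (h0 : v ≠ 0) : v ∈ cone p q := by
  refine ⟨?_, h0⟩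
  rw [bil_apply, form_eq, sub_eq_zero] at h
  exact (pow_left_inj₀ (normX_nonneg _) (normY_nonneg _) two_ne_zero).1 h

/-- The element of `O(p,q)` given by a matrix which preserves the quadratic form. -/
def ofMatrix (A : Mat p q) (h : ∀ v w, bil p q (A *ᵥ v) (A *ᵥ w) = bil p q v w) : G p q :=
  have hA : Aᵀ * Ipq p q * A = Ipq p q := by
    apply (Matrix.toBilin' (R₁ := ℝ)).injective
    refine LinearMap.ext fun v => LinearMap.ext fun w => ?_
    rw [Matrix.toBilin'_apply', ← Matrix.mulVec_mulVec, ← Matrix.mulVec_mulVec,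
      Matrix.dotProduct_mulVec v, Matrix.vecMul_transpose, ← bil_apply, h]
    rfl
  have hA' : (Ipq p q * Aᵀ * Ipq p q) * A = 1 := by
    rw [mul_assoc, mul_assoc, ← mul_assoc Aᵀ, hA, Ipq_mul_self]
  ⟨⟨A, Ipq p q * Aᵀ * Ipq p q, mul_eq_one_comm.1 hA', hA'⟩, hA⟩

/-- The matrix of the reflection in the hyperplane orthogonal to `w`. -/
def reflMat (w : Space p q) : Mat p q :=
  1 - (2 / bil p q w w) • Matrix.vecMulVec w (Ipq p q *ᵥ w)

theorem reflMat_mulVec (w v : Space p q) :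
    reflMat w *ᵥ v = v - (2 / bil p q w w * bil p q v w) • w := by
  rw [reflMat, Matrix.sub_mulVec, Matrix.one_mulVec, Matrix.smul_mulVec, Matrix.vecMulVec_mulVec,
    bil_comm v, bil_apply, op_smul_eq_smul, smul_smul, bil_apply w v, Ipq_mulVec, Ipq_mulVec]
  simp [dotProduct, Fintype.sum_sum_type]

/-- The reflection in the hyperplane orthogonal to `w`. -/
def refl (w : Space p q) (hw : bil p q w w ≠ 0) : G p q :=
  ofMatrix (reflMat w) fun u v => by
    simp only [reflMat_mulVec, map_sub, map_smul, LinearMap.sub_apply, LinearMap.smul_apply,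
      smul_eq_mul, bil_comm w]
    field_simp
    ring

theorem bil_sub_self (ξ η : cone p q) :
    bil p q ((ξ : Space p q) - η) ((ξ : Space p q) - η) = -2 * bil p q ξ η := by
  simp only [map_sub, LinearMap.sub_apply, bil_self_of_mem, bil_comm (η : Space p q) ξ]
  ring

/-- For isotropic `ξ`, `η` one has `⟨ξ-η, ξ-η⟩ = -2⟨ξ,η⟩`, so the reflection coefficient at `η` is
`-1` and the reflection adds `ξ - η` to `η`. -/
theorem refl_smul {ξ η : cone p q} (h : bil p q ((ξ : Space p q) - η) ((ξ : Space p q) - η) ≠ 0) :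
    refl _ h • η = ξ := by
  apply Subtype.ext
  rw [coe_smul]
  change reflMat _ *ᵥ _ = _
  have h1 := bil_sub_self ξ η
  rw [reflMat_mulVec, h1, map_sub (bil p q (η : Space p q)), bil_self_of_mem,
    bil_comm (η : Space p q)]
  have h2 : bil p q ξ η ≠ 0 := by
    intro h0
    rw [h1, h0] at h
    simp at h
  rw [show 2 / (-2 * bil p q (ξ : Space p q) η) * (bil p q ξ η - 0) = -1 by field_simp; simp]
  simp

/-- `G` acts transitively on the light cone. -/
theorem exists_smul_eq (ξ η : cone p q) : ∃ g : G p q, g • η = ξ := by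
  have key : ∀ ξ η : cone p q, bil p q ξ η ≠ 0 → ∃ g : G p q, g • η = ξ := fun ξ η h =>
    ⟨_, refl_smul (by rw [bil_sub_self]; simpa using h)⟩
  -- When `⟨ξ,η⟩ = 0`, two reflections are composed, passing through an isotropic `ζ` that pairs
  -- nontrivially with both.
  have key2 : ∀ ζ : cone p q, bil p q ζ ξ ≠ 0 → bil p q ζ η ≠ 0 → ∃ g : G p q, g • η = ξ := by
    intro ζ h1 h2
    obtain ⟨g, hg⟩ := key ζ η h2
    obtain ⟨h, hh⟩ := key ξ ζ (by rwa [bil_comm])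
    exact ⟨h * g, by rw [mul_smul, hg, hh]⟩
  by_cases h0 : bil p q ξ η = 0
  swap
  · exact key ξ η h0
  -- Applying `I_{p,q}` turns the form into the Euclidean inner product, where nonzero vectors have
  -- nonzero square; this supplies candidates for `ζ`.
  have hs1 : ∀ v w : Space p q, bil p q (Ipq p q *ᵥ v) w = v ⬝ᵥ w := fun v w => by
    rw [bil_eq_sum, Ipq_mulVec]
    simp [dotProduct, Fintype.sum_sum_type]
  have hs2 : ∀ v w : Space p q, bil p q (Ipq p q *ᵥ v) (Ipq p q *ᵥ w) = bil p q v w := fun v w => by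
    rw [bil_eq_sum, bil_eq_sum, Ipq_mulVec, Ipq_mulVec]
    simp
  have hpos : ∀ ξ : cone p q, (ξ : Space p q) ⬝ᵥ (ξ : Space p q) ≠ 0 := fun ξ h =>
    ξ.2.2 (dotProduct_self_eq_zero.1 h)
  have hcone : ∀ (ζ : Space p q) (w : Space p q), bil p q ζ ζ = 0 → bil p q ζ w ≠ 0 →
      ζ ∈ cone p q := fun ζ w h1 h2 => mem_cone_of_bil h1 (by rintro rfl; simp at h2)
  by_cases h1 : (ξ : Space p q) ⬝ᵥ (η : Space p q) = 0
  -- Here `ζ = I(ξ + η)`. It is isotropic because `⟨ξ,η⟩ = 0`, and its pairings with `ξ`, `η` are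
  -- `|ξ|²`, `|η|²` because `ξ·η = 0`.
  · have h2 : bil p q (Ipq p q *ᵥ (ξ : Space p q) + Ipq p q *ᵥ (η : Space p q)) ξ ≠ 0 := by
      rw [map_add, LinearMap.add_apply, hs1, hs1, dotProduct_comm (η : Space p q), h1, add_zero]
      exact hpos ξ
    refine key2 ⟨_, hcone _ _ ?_ h2⟩ h2 ?_
    · simp only [map_add, LinearMap.add_apply, hs2, bil_self_of_mem, bil_comm (η : Space p q) ξ, h0]
      simp
    · simp only [map_add, LinearMap.add_apply, hs1, h1, zero_add]
      exact hpos η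
  · refine key2 ⟨Ipq p q *ᵥ (ξ : Space p q), hcone _ ξ ?_ ?_⟩ ?_ ?_
    · rw [hs2, bil_self_of_mem]
    · rw [hs1]; exact hpos ξ
    · rw [hs1]; exact hpos ξ
    · rw [hs1]; exact h1

/-! ### The exponential of a matrix applied to a vector -/

section Exp

variable {ι : Type*} [Fintype ι] [DecidableEq ι]

theorem hasSum_exp_mulVec (A : Matrix ι ι ℝ) (v : ι → ℝ) :
    HasSum (fun n : ℕ => (n.factorial : ℝ)⁻¹ • (A ^ n *ᵥ v)) (NormedSpace.exp A *ᵥ v) := by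
  let _ : NormedRing (Matrix ι ι ℝ) := Matrix.linftyOpNormedRing
  let _ : NormedAlgebra ℝ (Matrix ι ι ℝ) := Matrix.linftyOpNormedAlgebra
  have h := NormedSpace.exp_series_hasSum_exp' (𝕂 := ℝ) A
  have hc : Continuous fun M : Matrix ι ι ℝ => M *ᵥ v := by fun_prop
  have h1 := h.map (AddMonoidHom.mk' (fun M : Matrix ι ι ℝ => M *ᵥ v)
    fun M N => Matrix.add_mulVec M N v) hc
  refine h1.congr_fun fun n => ?_
  simp [Matrix.smul_mulVec]

theorem exp_mulVec_of_eigenvector {A : Matrix ι ι ℝ} {v : ι → ℝ} {c : ℝ} (h : A *ᵥ v = c • v) :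
    NormedSpace.exp A *ᵥ v = Real.exp c • v := by
  have h1 : ∀ n : ℕ, A ^ n *ᵥ v = c ^ n • v := by
    intro n
    induction n with
    | zero => simp
    | succ n ih =>
      rw [pow_succ, ← Matrix.mulVec_mulVec, h, Matrix.mulVec_smul, ih, smul_smul, pow_succ,
        mul_comm]
  have h2 := hasSum_exp_mulVec A v
  have h3 : HasSum (fun n : ℕ => (n.factorial : ℝ)⁻¹ • (A ^ n *ᵥ v)) (Real.exp c • v) := by
    have := (NormedSpace.exp_series_hasSum_exp' (𝕂 := ℝ) c).smul_const v
    rw [← Real.exp_eq_exp_ℝ] at this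
    simpa [h1, smul_smul] using this
  exact h2.unique h3

theorem exp_mulVec_of_nilpotent {A : Matrix ι ι ℝ} {v w u : ι → ℝ} (h1 : A *ᵥ v = w)
    (h2 : A *ᵥ w = u) (h3 : A *ᵥ u = 0) :
    NormedSpace.exp A *ᵥ v = v + w + (1 / 2 : ℝ) • u := by
  have h4 : ∀ n : ℕ, 3 ≤ n → A ^ n *ᵥ v = 0 := by
    intro n hn
    obtain ⟨k, rfl⟩ := Nat.exists_eq_add_of_le' hn
    rw [pow_add, ← Matrix.mulVec_mulVec, pow_succ, pow_two, ← Matrix.mulVec_mulVec,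
      ← Matrix.mulVec_mulVec, h1, h2, h3, Matrix.mulVec_zero]
  have h5 := hasSum_exp_mulVec A v
  have h6 := hasSum_sum_of_ne_finset_zero (L := SummationFilter.unconditional ℕ)
    (s := Finset.range 3)
    (f := fun n : ℕ => (n.factorial : ℝ)⁻¹ • (A ^ n *ᵥ v)) fun n hn => by
      rw [h4 n (by simpa using hn), smul_zero]
  rw [h5.unique h6]
  simp [Finset.sum_range_succ, h1, pow_two, ← Matrix.mulVec_mulVec, h2]

end Exp

end Reflections

/-! ### The parabolic subgroup and the stabilizer of the base point -/

section Parabolic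

section ParabolicAction

variable {p q : ℕ}

theorem bil_single_first [NeZero p] (v : Space p q) :
    bil p q v (Pi.single (first p q) 1) = v (first p q) := by
  rw [bil_eq_sum]
  simp [first, Pi.single_apply]

theorem bil_single_last [NeZero q] (v : Space p q) :
    bil p q v (Pi.single (last p q) 1) = -v (last p q) := by
  rw [bil_eq_sum]
  simp [last, Pi.single_apply]

theorem mat_expG (X : Mat p q) (hX : X ∈ lieAlg p q) : mat (expG X hX) = NormedSpace.exp X := rfl

theorem m0_smul (ξ : cone p q) : m0 p q • ξ = negCone ξ :=
  Subtype.ext (mat_m0_mulVec _)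

theorem vecMulVec_Ipq_mulVec (u w v : Space p q) :
    Matrix.vecMulVec u (Ipq p q *ᵥ w) *ᵥ v = bil p q v w • u := by
  rw [Matrix.vecMulVec_mulVec, op_smul_eq_smul, bil_apply, dotProduct_comm]

theorem mem_lieAlg_of_skew {X : Mat p q}
    (h : ∀ v w, bil p q (X *ᵥ v) w + bil p q v (X *ᵥ w) = 0) : X ∈ lieAlg p q := by
  apply (Matrix.toBilin' (R₁ := ℝ)).injective
  refine LinearMap.ext fun v => LinearMap.ext fun w => ?_
  have := h v w
  rw [bil_apply, bil_apply] at this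
  rw [Matrix.toBilin'_apply', Matrix.add_mulVec, dotProduct_add, ← Matrix.mulVec_mulVec,
    ← Matrix.mulVec_mulVec, Matrix.dotProduct_mulVec v, Matrix.vecMul_transpose, this]
  simp

variable [NeZero p] [NeZero q]

/-! ### The action of the parabolic subgroup on the base point -/

theorem first_ne_last : first p q ≠ last p q := Sum.inl_ne_inr

variable (p q) in
/-- The point `ᵗ(1, 0, …, 0, -1)` of the light cone. -/
def oppBase : Space p q := Pi.single (first p q) 1 - Pi.single (last p q) 1

theorem coe_base : (base p q : Space p q) = Pi.single (first p q) 1 + Pi.single (last p q) 1 := rfl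

theorem bil_base (v : Space p q) : bil p q v (base p q) = v (first p q) - v (last p q) := by
  rw [coe_base, map_add, bil_single_first, bil_single_last, sub_eq_add_neg]

theorem bil_oppBase (v : Space p q) : bil p q v (oppBase p q) = v (first p q) + v (last p q) := by
  rw [oppBase, map_sub, bil_single_first, bil_single_last, sub_neg_eq_add]

theorem base_first : (base p q : Space p q) (first p q) = 1 := by
  simp [coe_base, first_ne_last]

theorem base_last : (base p q : Space p q) (last p q) = 1 := by
  simp [coe_base, first_ne_last.symm]

theorem oppBase_first : oppBase p q (first p q) = 1 := by
  simp [oppBase, first_ne_last]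

theorem oppBase_last : oppBase p q (last p q) = -1 := by
  simp [oppBase, first_ne_last.symm]

theorem bil_oppBase_oppBase : bil p q (oppBase p q) (oppBase p q) = 0 := by
  rw [bil_oppBase, oppBase_first, oppBase_last, add_neg_cancel]

theorem bil_base_oppBase : bil p q (base p q) (oppBase p q) = 2 := by
  rw [bil_oppBase, base_first, base_last]; norm_num

theorem bil_oppBase_base : bil p q (oppBase p q) (base p q) = 2 := by
  rw [bil_comm, bil_base_oppBase]

variable (p q) in
/-- `oppBase` as a point of the light cone. -/
def oppBaseCone : cone p q := ⟨oppBase p q, mem_cone_of_bil bil_oppBase_oppBase fun h => by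
  have := oppBase_first (p := p) (q := q)
  rw [h] at this
  simp at this⟩

theorem E_mulVec (v : Space p q) :
    E p q *ᵥ v = v (last p q) • Pi.single (first p q) 1 + v (first p q) • Pi.single (last p q) 1 := by
  rw [E, Matrix.add_mulVec]
  funext k
  simp [Matrix.mulVec, dotProduct, Matrix.single_apply, Pi.single_apply, ite_and, eq_comm]

theorem E_mulVec_base : E p q *ᵥ (base p q : Space p q) = base p q := by
  rw [E_mulVec, base_first, base_last, one_smul, one_smul, coe_base]

theorem expE_smul_base (t : ℝ) :
    expE p q t • base p q = dilate (Real.exp t) (Real.exp_pos t) (base p q) := by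
  apply Subtype.ext
  rw [coe_smul, expE, mat_expG]
  exact exp_mulVec_of_eigenvector (by rw [Matrix.smul_mulVec, E_mulVec_base])

theorem expE_zero : expE p q 0 = 1 := by
  apply Subtype.ext
  apply Units.ext
  change NormedSpace.exp ((0 : ℝ) • E p q) = 1
  rw [zero_smul, NormedSpace.exp_zero]

theorem Nmax_smul_base {n : G p q} (hn : n ∈ Nmax p q) : n • base p q = base p q := by
  obtain ⟨X, hX, hEX, rfl⟩ := hn
  -- From `[E, X] = X` and `E ξ° = ξ°`, the vector `X ξ°` would be an eigenvector of `E` for the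
  -- eigenvalue 2. As `E` only exchanges the first and last coordinates and kills the others, the
  -- vector is zero.
  have h1 : E p q *ᵥ (X *ᵥ (base p q : Space p q)) = (2 : ℝ) • (X *ᵥ (base p q : Space p q)) := by
    have := congrArg (fun Y => Y *ᵥ (base p q : Space p q)) hEX
    simp only [Matrix.sub_mulVec, ← Matrix.mulVec_mulVec, E_mulVec_base] at this
    rw [two_smul, ← sub_eq_iff_eq_add]
    exact this
  rw [E_mulVec] at h1
  set w := X *ᵥ (base p q : Space p q) with hw
  have h2 := congrFun h1 (first p q)
  have h3 := congrFun h1 (last p q)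
  simp [first_ne_last, first_ne_last.symm] at h2 h3
  have h4 : w (first p q) = 0 := by linarith
  have h5 : w (last p q) = 0 := by linarith
  rw [h4, h5, zero_smul, zero_smul, add_zero] at h1
  have h6 : w = 0 := by
    simpa using h1.symm
  apply Subtype.ext
  rw [coe_smul, mat_expG, exp_mulVec_of_eigenvector (c := 0) (by rw [← hw, h6, zero_smul])]
  simp

theorem one_mem_Nmax : (1 : G p q) ∈ Nmax p q := by
  refine ⟨0, by simp [lieAlg], by simp, ?_⟩
  apply Subtype.ext
  apply Units.ext
  exact (NormedSpace.exp_zero (𝔸 := Mat p q)).symm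

theorem Mplus_smul_base {m : G p q} (hm : m ∈ Mplus p q) : m • base p q = base p q := by
  apply Subtype.ext
  rw [coe_smul, coe_base, Matrix.mulVec_add, hm.1, hm.2]

theorem chi_inv (ε : ℤˣ) (m : Mmax p q) : chi ε m⁻¹ = chi ε m := by
  rw [map_inv, Int.units_inv_eq_self]

theorem chi_of_mem (ε : ℤˣ) {m : Mmax p q} (hm : (m : G p q) ∈ Mplus p q) : chi ε m = 1 :=
  if_pos hm

theorem chi_of_not_mem (ε : ℤˣ) {m : Mmax p q} (hm : (m : G p q) ∉ Mplus p q) : chi ε m = ε :=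
  if_neg hm

theorem apply_Mmax_smul_base {a : ℂ} {ε : ℤˣ} {F : cone p q → ℂ} (hF : F ∈ S p q a ε) (g : G p q)
    (m : Mmax p q) : F (g • (m : G p q) • base p q) = ((chi ε m⁻¹ : ℤ) : ℂ) * F (g • base p q) := by
  rw [chi_inv]
  by_cases hm : (m : G p q) ∈ Mplus p q
  · rw [chi_of_mem ε hm, Mplus_smul_base hm]
    simp
  · rw [chi_of_not_mem ε hm, ← hF.2.2, ← smul_negCone]
    have h1 := Mplus_smul_base ((Mmax_cases m.2).resolve_left hm)
    rw [mul_smul] at h1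
    have h2 : (m : G p q) • base p q = negCone (base p q) := by
      rw [← m0_smul]
      nth_rewrite 2 [← h1]
      rw [← mul_smul, m0_mul_self, one_smul]
    rw [h2]

/-! ### From homogeneous functions to the degenerate principal series -/

theorem exp_mul_eq_cpow (t : ℝ) (a : ℂ) : Complex.exp (t * a) = ((Real.exp t : ℝ) : ℂ) ^ a := by
  rw [Complex.cpow_def_of_ne_zero (by exact_mod_cast (Real.exp_pos t).ne'),
    ← Complex.ofReal_log (Real.exp_pos t).le, Real.log_exp]

/-- Moving `m`, `exp(tE)` and `n` onto the base point gives a sign, the dilation by `e^t`, and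
nothing. The hypothesis on `a` matches the degree with the exponent of the induced representation.
-/
theorem pullback_mem_Ind {lam a : ℂ} (ha : -(lam + rho p q) = a) {ε : ℤˣ} {F : cone p q → ℂ}
    (hF : F ∈ S p q a ε) : (fun g : G p q => F (g • base p q)) ∈ Ind p q lam ε := by
  refine ⟨?_, fun g m t n hn => ?_⟩
  · refine IsSmooth.comp (f := F) hF.1 (fun g => g • base p q)
      (fun A i => ∑ j, A i j * (base p q : Space p q) j)
      (fun g => ⟨Set.univ, isOpen_univ, trivial, ContDiff.contDiffOn ?_⟩) fun g => rfl
    fun_prop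
  · simp only [mul_smul]
    rw [Nmax_smul_base hn, expE_smul_base, smul_dilate, smul_dilate, hF.2.1, ha,
      apply_Mmax_smul_base hF, exp_mul_eq_cpow]
    ring

/-! ### The stabilizer of the base point -/

/-- The nilpotent matrix `v ↦ ⟨v, ξ°⟩ u - ⟨v, u⟩ ξ°`. -/
def nilMat (u : Space p q) : Mat p q :=
  Matrix.vecMulVec u (Ipq p q *ᵥ (base p q : Space p q)) -
    Matrix.vecMulVec (base p q : Space p q) (Ipq p q *ᵥ u)

theorem nilMat_mulVec (u v : Space p q) :
    nilMat u *ᵥ v = bil p q v (base p q) • u - bil p q v u • (base p q : Space p q) := by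
  rw [nilMat, Matrix.sub_mulVec, vecMulVec_Ipq_mulVec, vecMulVec_Ipq_mulVec]

theorem nilMat_mem (u : Space p q) : nilMat u ∈ lieAlg p q := by
  refine mem_lieAlg_of_skew fun v w => ?_
  simp only [nilMat_mulVec, map_sub, map_smul, LinearMap.sub_apply, LinearMap.smul_apply,
    smul_eq_mul, bil_comm u w, bil_comm (base p q : Space p q) w]
  ring

theorem E_skew (v w : Space p q) : bil p q (E p q *ᵥ v) w = -bil p q v (E p q *ᵥ w) := by
  rw [bil_comm, E_mulVec, E_mulVec]
  simp only [map_add, map_smul, bil_single_first, bil_single_last, smul_eq_mul]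
  ring

/-- `E` is skew for the form, fixes `ξ°` and kills `u`, so commuting with `E` reproduces each of the
two rank-one terms. -/
theorem nilMat_bracket {u : Space p q} (hu : E p q *ᵥ u = 0) :
    E p q * nilMat u - nilMat u * E p q = nilMat u := by
  apply Matrix.mulVec_injective
  funext v
  change (E p q * nilMat u - nilMat u * E p q) *ᵥ v = nilMat u *ᵥ v
  rw [Matrix.sub_mulVec, ← Matrix.mulVec_mulVec, ← Matrix.mulVec_mulVec]
  simp only [nilMat_mulVec, Matrix.mulVec_sub, Matrix.mulVec_smul, hu, E_mulVec_base, E_skew,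
    map_zero, smul_zero, neg_zero, zero_smul]
  simp [neg_add_eq_sub]

theorem Nmax_inv {n : G p q} (hn : n ∈ Nmax p q) : n⁻¹ ∈ Nmax p q := by
  obtain ⟨X, hX, hEX, rfl⟩ := hn
  have hX' : -X ∈ lieAlg p q := by
    change (-X)ᵀ * Ipq p q + Ipq p q * (-X) = 0
    have : Xᵀ * Ipq p q + Ipq p q * X = 0 := hX
    rw [Matrix.transpose_neg, neg_mul, mul_neg, ← neg_add, this, neg_zero]
  refine ⟨-X, hX', by rw [mul_neg, neg_mul, ← neg_sub', hEX], ?_⟩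
  refine inv_eq_of_mul_eq_one_left ?_
  apply Subtype.ext
  apply Units.ext
  change NormedSpace.exp (-X) * NormedSpace.exp X = 1
  rw [← Matrix.exp_add_of_commute _ _ (Commute.neg_left (Commute.refl X)), neg_add_cancel,
    NormedSpace.exp_zero]

/-- `N` acts transitively on the points `ζ` of the light cone with `⟨ζ, ξ°⟩ = 2`. -/
theorem exists_Nmax_mulVec {ζ : Space p q} (h0 : bil p q ζ ζ = 0) (h1 : bil p q ζ (base p q) = 2) :
    ∃ n ∈ Nmax p q, mat n *ᵥ oppBase p q = ζ := by
  set b : Space p q := (base p q : Space p q)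
  set c : Space p q := oppBase p q
  have hbb : bil p q b b = 0 := bil_self_of_mem (base p q)
  have hbc : bil p q b c = 2 := bil_base_oppBase
  have hcb : bil p q c b = 2 := bil_oppBase_base
  have hcc : bil p q c c = 0 := bil_oppBase_oppBase
  -- These come from the decomposition `ζ = c + 2u + α b` with `u` orthogonal to `b` and `c`. The
  -- coefficient of `c` is 1 by `h1`, and isotropy of `ζ` forces `α = -⟨u,u⟩`.
  set α : ℝ := bil p q ζ c / 2 with hα
  set u : Space p q := (1 / 2 : ℝ) • (ζ - c - α • b) with hu
  have hub : bil p q u b = 0 := by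
    simp only [hu, map_sub, map_smul, LinearMap.sub_apply, LinearMap.smul_apply, smul_eq_mul, h1,
      hcb, hbb]
    ring
  have huc : bil p q u c = 0 := by
    simp only [hu, map_sub, map_smul, LinearMap.sub_apply, LinearMap.smul_apply, smul_eq_mul,
      hcc, hbc, hα]
    ring
  have hζ : ζ = c + (2 : ℝ) • u + α • b := by
    rw [hu]
    module
  have huu : α = -bil p q u u := by
    rw [hζ] at h0
    simp only [map_add, map_smul, LinearMap.add_apply, LinearMap.smul_apply, smul_eq_mul,
      hcc, hbc, hcb, hbb, hub, huc, bil_comm b u, bil_comm c u] at h0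
    linarith
  have hEu : E p q *ᵥ u = 0 := by
    rw [bil_base] at hub
    rw [bil_oppBase] at huc
    rw [E_mulVec, show u (first p q) = 0 by linarith, show u (last p q) = 0 by linarith]
    simp
  refine ⟨expG (nilMat u) (nilMat_mem u), ⟨_, nilMat_mem u, nilMat_bracket hEu, rfl⟩, ?_⟩
  -- The chain is `c ↦ 2u ↦ -2⟨u,u⟩ b ↦ 0`, so the exponential stops at the quadratic term, with
  -- value `c + 2u - ⟨u,u⟩ b = ζ`.
  rw [mat_expG, exp_mulVec_of_nilpotent (w := (2 : ℝ) • u) (u := (-2 * bil p q u u) • b)]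
  · have h2 : (1 / 2 : ℝ) • (-2 * bil p q u u) • b = α • b := by
      rw [← mul_smul]
      congr 1
      linarith
    rw [h2, ← hζ]
  · rw [nilMat_mulVec]
    change bil p q c b • u - bil p q c u • b = _
    rw [hcb, bil_comm, huc, zero_smul, sub_zero]
  · rw [nilMat_mulVec]
    change bil p q ((2 : ℝ) • u) b • u - bil p q ((2 : ℝ) • u) u • b = _
    rw [map_smul, LinearMap.smul_apply, LinearMap.smul_apply, hub]
    simp
  · rw [nilMat_mulVec]
    change bil p q ((-2 * bil p q u u) • b) b • u - bil p q ((-2 * bil p q u u) • b) u • b = _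
    rw [map_smul, LinearMap.smul_apply, LinearMap.smul_apply, hbb, bil_comm b, hub]
    simp

/-- The stabilizer of the base point is `M₊ N`. -/
theorem exists_eq_mul_of_smul_base {g : G p q} (hg : g • base p q = base p q) :
    ∃ m ∈ Mplus p q, ∃ n ∈ Nmax p q, g = m * n := by
  have hgb : mat g *ᵥ (base p q : Space p q) = base p q := congrArg Subtype.val hg
  -- With `n` carrying `c` to `g⁻¹ c`, the product `g n` fixes both `b` and `c`, hence the first and
  -- last basis vectors, which are their half sum and half difference.
  obtain ⟨n, hn, hnc⟩ := exists_Nmax_mulVec (ζ := mat g⁻¹ *ᵥ oppBase p q)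
    (by rw [bil_mulVec, bil_oppBase_oppBase])
    (by
      rw [← bil_mulVec g, Matrix.mulVec_mulVec, mat_mul_inv, Matrix.one_mulVec, hgb,
        bil_oppBase_base])
  refine ⟨g * n, ?_, n⁻¹, Nmax_inv hn, by simp⟩
  have hmat : mat (g * n) = mat g * mat n := rfl
  have h1 : mat (g * n) *ᵥ (base p q : Space p q) = base p q := by
    have h := congrArg Subtype.val (Nmax_smul_base hn)
    rw [coe_smul] at h
    rw [hmat, ← Matrix.mulVec_mulVec, h, hgb]
  have h2 : mat (g * n) *ᵥ oppBase p q = oppBase p q := by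
    rw [hmat, ← Matrix.mulVec_mulVec, hnc, Matrix.mulVec_mulVec, mat_mul_inv, Matrix.one_mulVec]
  have hf : (Pi.single (first p q) 1 : Space p q) =
      (1 / 2 : ℝ) • ((base p q : Space p q) + oppBase p q) := by
    rw [coe_base, oppBase]; module
  have hl : (Pi.single (last p q) 1 : Space p q) =
      (1 / 2 : ℝ) • ((base p q : Space p q) - oppBase p q) := by
    rw [coe_base, oppBase]; module
  refine ⟨?_, ?_⟩
  · rw [hf, Matrix.mulVec_smul, Matrix.mulVec_add, h1, h2]
  · rw [hl, Matrix.mulVec_smul, Matrix.mulVec_sub, h1, h2]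

end ParabolicAction

end Parabolic

/-! ### The induced picture and the intertwining maps -/

section Intertwining

section Iso

variable {p q : ℕ} [NeZero p] [NeZero q]

/-! ### From the degenerate principal series to homogeneous functions -/

/-- The two group elements differ on the right by an element of `M₊N`, on which the inducing
character is trivial. -/
theorem apply_eq_of_smul_base_eq {lam : ℂ} {ε : ℤˣ} {f : G p q → ℂ} (hf : f ∈ Ind p q lam ε)
    {g h : G p q} (hgh : g • base p q = h • base p q) : f g = f h := by
  obtain ⟨m, hm, n, hn, hmn⟩ := exists_eq_mul_of_smul_base (g := h⁻¹ * g)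
    (by rw [mul_smul, hgh, inv_smul_smul])
  have hm' : m ∈ Mmax p q := Subgroup.subset_closure (Or.inl hm)
  have h1 := hf.2 h ⟨m, hm'⟩ 0 n hn
  have h2 : ((⟨m, hm'⟩ : Mmax p q) : G p q) ∈ Mplus p q := hm
  rw [chi_inv, chi_of_mem ε h2, expE_zero] at h1
  have h3 : g = h * m * 1 * n := by rw [mul_one, mul_assoc, ← hmn, mul_inv_cancel_left]
  rw [h3]
  simpa using h1

/-- The function on the light cone defined by a function on `G`. -/
def descend (f : G p q → ℂ) (ξ : cone p q) : ℂ := f (exists_smul_eq ξ (base p q)).choose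

theorem descend_smul_base {lam : ℂ} {ε : ℤˣ} {f : G p q → ℂ} (hf : f ∈ Ind p q lam ε)
    (g : G p q) : descend f (g • base p q) = f g :=
  apply_eq_of_smul_base_eq hf (exists_smul_eq (g • base p q) (base p q)).choose_spec

/-- The functions on the light cone coming from smooth functions on `G` are smooth, since the
reflections provide smooth local sections of the orbit map. -/
theorem isSmooth_descend {lam : ℂ} {ε : ℤˣ} {f : G p q → ℂ} (hf : f ∈ Ind p q lam ε) :
    IsSmooth (Subtype.val : cone p q → Space p q) (descend f) := by
  intro ξ₀
  -- This `g` puts `g⁻¹ ξ₀` at the opposite base point, which pairs to 2 with `ξ°`. A single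
  -- reflection then carries `ξ°` to `g⁻¹ ξ` for all `ξ` near `ξ₀`.
  obtain ⟨g, hg⟩ := exists_smul_eq ξ₀ (oppBaseCone p q)
  set w : Space p q → Space p q := fun v => mat g⁻¹ *ᵥ v - base p q with hw
  have hwd : ContDiff ℝ ∞ w := (contDiff_mulVec _).sub contDiff_const
  set N : Space p q → ℝ := fun v => bil p q (w v) (w v) with hN
  have hNd : ContDiff ℝ ∞ N := by
    have hb : N = fun v => ∑ i, w v (Sum.inl i) * w v (Sum.inl i) -
        ∑ j, w v (Sum.inr j) * w v (Sum.inr j) := funext fun v => bil_eq_sum _ _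
    rw [hb]
    have hk : ∀ k, ContDiff ℝ ∞ fun v => w v k := fun k => contDiff_pi.1 hwd k
    exact (ContDiff.sum fun i _ => (hk _).mul (hk _)).sub
      (ContDiff.sum fun i _ => (hk _).mul (hk _))
  have hU : IsOpen {v | N v ≠ 0} := isOpen_ne_fun hNd.continuous continuous_const
  -- The local section `ξ ↦ g · refl(g⁻¹ξ - ξ°)`, written as a matrix-valued map on an open set of
  -- the ambient space; its entries are smooth where the norm `N` in the denominator is nonzero.
  set s : Space p q → Fin p ⊕ Fin q → Fin p ⊕ Fin q → ℝ := fun v i j =>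
    (mat g * reflMat (w v)) i j with hs
  have hsd : ContDiffOn ℝ ∞ s {v | N v ≠ 0} := by
    refine contDiffOn_pi.2 fun i => contDiffOn_pi.2 fun j => ?_
    simp only [hs, Matrix.mul_apply]
    refine ContDiffOn.sum fun k _ => contDiffOn_const.mul ?_
    have hk : ∀ k, ContDiff ℝ ∞ fun v => w v k := fun k => contDiff_pi.1 hwd k
    have hIk : ContDiff ℝ ∞ fun v => (Ipq p q *ᵥ w v) j :=
      contDiff_pi.1 ((contDiff_mulVec (Ipq p q)).comp hwd) j
    simp only [reflMat, Matrix.sub_apply, Matrix.smul_apply, Matrix.vecMulVec_apply, smul_eq_mul]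
    exact contDiffOn_const.sub ((contDiffOn_const.div hNd.contDiffOn fun v hv => hv).mul
      ((hk k).mul hIk).contDiffOn)
  have hsec : ∀ ξ : cone p q, (hξ : N ξ ≠ 0) →
      (g * refl (w ξ) hξ) • base p q = ξ ∧ entries p q (g * refl (w ξ) hξ) = s ξ := by
    intro ξ hξ
    refine ⟨?_, rfl⟩
    have hr : refl (w ξ) hξ • base p q = g⁻¹ • ξ := refl_smul (ξ := g⁻¹ • ξ) hξ
    rw [mul_smul, hr, smul_inv_smul]
  have hN0 : N ξ₀ ≠ 0 := by
    have h1 : mat g⁻¹ *ᵥ (ξ₀ : Space p q) = oppBaseCone p q := by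
      rw [← coe_smul, ← hg, inv_smul_smul]
    simp only [hN, hw, h1, bil_sub_self]
    rw [show bil p q (oppBaseCone p q : Space p q) (base p q) = 2 from bil_oppBase_base]
    norm_num
  obtain ⟨O, hO, hmO, H, hH, hfH⟩ := hf.1 (g * refl (w ξ₀) hN0)
  rw [(hsec ξ₀ hN0).2] at hmO
  refine ⟨{v | N v ≠ 0} ∩ s ⁻¹' O, hsd.continuousOn.isOpen_inter_preimage hU hO, ⟨hN0, hmO⟩,
    fun v => H (s v), hH.comp (hsd.mono Set.inter_subset_left) fun v hv => hv.2, ?_⟩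
  rintro ξ ⟨hξ, hξO⟩
  obtain ⟨h1, h2⟩ := hsec ξ hξ
  have h3 := hfH (g * refl (w ξ) hξ) (by rw [h2]; exact hξO)
  rw [h2] at h3
  change descend f ξ = H (s ξ)
  rw [← h3, ← descend_smul_base hf, h1]

/-- Dilation by `t` and negation at `g ξ°` are right multiplications of `g` by `exp((log t) E)` and
by `m₀`, so homogeneity and parity are special cases of the equivariance on `G`. -/
theorem descend_mem_S {lam a : ℂ} (ha : -(lam + rho p q) = a) {ε : ℤˣ} {f : G p q → ℂ}
    (hf : f ∈ Ind p q lam ε) : descend f ∈ S p q a ε := by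
  refine ⟨isSmooth_descend hf, fun t ht ξ => ?_, fun ξ => ?_⟩
  · obtain ⟨g, rfl⟩ := exists_smul_eq ξ (base p q)
    have h1 := hf.2 g 1 (Real.log t) 1 one_mem_Nmax
    rw [mul_one, Subgroup.coe_one, mul_one, inv_one, map_one, ha, exp_mul_eq_cpow,
      Real.exp_log ht] at h1
    have h2 : dilate t ht (g • base p q) = (g * expE p q (Real.log t)) • base p q := by
      rw [mul_smul, expE_smul_base, smul_dilate]
      congr 1
      exact (Real.exp_log ht).symm
    rw [h2, descend_smul_base hf, descend_smul_base hf, h1]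
    simp
  · obtain ⟨g, rfl⟩ := exists_smul_eq ξ (base p q)
    have hm : m0 p q ∈ Mmax p q := Subgroup.subset_closure (Or.inr rfl)
    have h1 := hf.2 g ⟨m0 p q, hm⟩ 0 1 one_mem_Nmax
    have h2 : ((⟨m0 p q, hm⟩ : Mmax p q) : G p q) ∉ Mplus p q := m0_not_mem
    rw [mul_one, expE_zero, mul_one, chi_inv, chi_of_not_mem ε h2] at h1
    rw [← smul_negCone, ← m0_smul, ← mul_smul, descend_smul_base hf, descend_smul_base hf, h1]
    simp

/-- `F ↦ (g ↦ F (g ξ°))` as a linear equivalence. -/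
def coneEquivInd {lam a : ℂ} (ha : -(lam + rho p q) = a) (ε : ℤˣ) :
    S p q a ε ≃ₗ[ℂ] Ind p q lam ε where
  toFun F := ⟨fun g => (F : cone p q → ℂ) (g • base p q), pullback_mem_Ind ha F.2⟩
  map_add' _ _ := rfl
  map_smul' _ _ := rfl
  invFun f := ⟨descend f, descend_mem_S ha f.2⟩
  left_inv F := by
    refine Subtype.ext (funext fun ξ => ?_)
    change (F : cone p q → ℂ) ((exists_smul_eq ξ (base p q)).choose • base p q) = _
    rw [(exists_smul_eq ξ (base p q)).choose_spec]
  right_inv f := Subtype.ext (funext fun g => descend_smul_base f.2 g)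

/-- The isomorphism of `S^{a,ε}(Ξ)` with the degenerate principal series. -/
def coneRepEquiv {lam a : ℂ} (ha : -(lam + rho p q) = a) (ε : ℤˣ) :
    Representation.Equiv (coneRep p q a ε) (indRep p q lam ε) :=
  Representation.Equiv.mk (coneEquivInd ha ε) fun h => by
    refine LinearMap.ext fun F => Subtype.ext (funext fun g => ?_)
    change (F : cone p q → ℂ) (h⁻¹ • g • base p q) = (F : cone p q → ℂ) ((h⁻¹ * g) • base p q)
    rw [mul_smul]

end Iso

/-! ### The representation on the kernel of the Yamabe operator -/

variable {p q : ℕ}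

/-- `V^{p,q}` as a subrepresentation of `C^∞(M)`. -/
def Vrep (hp : 2 ≤ p) (hq : 2 ≤ q) : Subrepresentation (varpi p q (((p : ℂ) + q - 4) / 2)) where
  toSubmodule := V p q
  apply_mem_toSubmodule g _ hv := varpi_mem_V hp hq g hv

/-- The homogeneous extension of the solutions of the Yamabe equation to the light cone. -/
def toConeMap (hp : 2 ≤ p) (hq : 2 ≤ q) {r : ℤ} (hr : (p : ℤ) - q = 2 * r) :
    Representation.IntertwiningMap (Vrep hp hq).toRepresentation
      (coneRep p q (-(((p : ℂ) + q - 4) / 2)) ((-1) ^ r)) where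
  toFun f := ⟨fun ξ => homExt (-(((p : ℂ) + q - 4) / 2)) (f : SmoothM p q).1 ξ,
    homExt_mem_S _ _ (f : SmoothM p q).2 fun z => by
      rw [coe_neg_one_zpow]
      exact apply_negM hp hq hr f.2 z⟩
  map_add' f g := by
    refine Subtype.ext (funext fun ξ => ?_)
    change homExt _ ((f : SmoothM p q).1 + (g : SmoothM p q).1) _ = homExt _ _ _ + homExt _ _ _
    simp only [homExt, extend_add, mul_add]
  map_smul' c f := by
    refine Subtype.ext (funext fun ξ => ?_)
    change homExt _ (c • (f : SmoothM p q).1) _ = c * homExt _ _ _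
    simp only [homExt, extend_smul, smul_eq_mul, mul_left_comm]
  isIntertwining' h := by
    refine LinearMap.ext fun f => Subtype.ext (funext fun ξ => ?_)
    exact homExt_varpi _ h f ξ

theorem toConeMap_apply_toCone (hp : 2 ≤ p) (hq : 2 ≤ q) {r : ℤ} (hr : (p : ℤ) - q = 2 * r)
    (f : (Vrep hp hq).toSubmodule) (z : spheres p q) :
    (toConeMap hp hq hr f : cone p q → ℂ) (toCone z) = (f : SmoothM p q).1 z := by
  change homExt _ _ ((toCone z : cone p q) : Space p q) = _
  rw [homExt_cone, proj_toCone, show nu (toCone z : Space p q) = 1 from z.2.1,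
    Complex.ofReal_one, Complex.one_cpow, one_mul]

theorem toConeMap_injective (hp : 2 ≤ p) (hq : 2 ≤ q) {r : ℤ} (hr : (p : ℤ) - q = 2 * r) :
    Function.Injective (toConeMap hp hq hr) := by
  intro f g hfg
  refine Subtype.ext (Subtype.ext (funext fun z => ?_))
  rw [← toConeMap_apply_toCone hp hq hr f z, ← toConeMap_apply_toCone hp hq hr g z, hfg]

end Intertwining

end OPQ

end

/-! ### The embedding into the degenerate principal series -/

theorem lemma3p7p2 (p q : ℕ) [NeZero p] [NeZero q] (hp : 2 ≤ p) (hq : 2 ≤ q)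
    (hpq : Even (p + q)) :
    ∃ W : Subrepresentation (OPQ.varpi p q (((p : ℂ) + q - 4) / 2)),
      W.toSubmodule = OPQ.V p q ∧
      ∃ J : Representation.IntertwiningMap W.toRepresentation
          (OPQ.coneRep p q (-(((p : ℂ) + q - 4) / 2)) ((-1) ^ (((p : ℤ) - q) / 2))),
        Function.Injective J ∧
        (∀ (f : W.toSubmodule) (z : OPQ.spheres p q),
          (J f : OPQ.cone p q → ℂ) (OPQ.toCone z) = (f : OPQ.SmoothM p q).1 z) ∧
        ∃ Φ : Representation.Equiv
            (OPQ.coneRep p q (-(((p : ℂ) + q - 4) / 2)) ((-1) ^ (((p : ℤ) - q) / 2)))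
            (OPQ.indRep p q (-1) ((-1) ^ (((p : ℤ) - q) / 2))),
          (∀ (F : OPQ.S p q (-(((p : ℂ) + q - 4) / 2)) ((-1) ^ (((p : ℤ) - q) / 2)))
              (g : OPQ.G p q),
            (Φ F : OPQ.G p q → ℂ) g = (F : OPQ.cone p q → ℂ) (g • OPQ.base p q)) ∧
          ∃ T : Representation.IntertwiningMap W.toRepresentation
              (OPQ.indRep p q (-1) ((-1) ^ (((p : ℤ) - q) / 2))),
            Function.Injective T ∧ ∀ f : W.toSubmodule, T f = Φ (J f) := by
  -- Since `p + q` is even, so is `p - q`, and the integer division in the exponent of the sign is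
  -- exact.
  have hr : (p : ℤ) - q = 2 * (((p : ℤ) - q) / 2) := by
    obtain ⟨k, hk⟩ := hpq
    omega
  have ha : -((-1 : ℂ) + OPQ.rho p q) = -(((p : ℂ) + q - 4) / 2) := by
    rw [OPQ.rho]; ring
  have hJ := OPQ.toConeMap_injective hp hq hr
  refine ⟨OPQ.Vrep hp hq, rfl, OPQ.toConeMap hp hq hr, hJ,
    OPQ.toConeMap_apply_toCone hp hq hr, OPQ.coneRepEquiv ha _, fun F g => rfl,
    (OPQ.coneRepEquiv ha _).toIntertwiningMap.comp (OPQ.toConeMap hp hq hr), ?_, fun f => rfl⟩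
  exact (EquivLike.injective (OPQ.coneRepEquiv ha _)).comp hJ
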